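/- Let $\mathbf d=(d(1),\dots,d(n))$ be a non-decreasing sequence of positive integers with even sum $M=\sum_{i=1}^n d(i)$ and largest entry $\Delta$. For a non-empty set $S=\{i_1<\dots<i_s\}\subseteq\{1,\dots,n\}$ let $d(S)=\sum_{i\in S}d(i)$ and $\gamma=d(S)/M$, and for $\delta>0$ let $J=\delta^{-1/16}\gamma^{-1}\log M$. Let $Z_j\sim\mathrm{Bin}(j,\gamma)$, and put $N(k)=\left\lfloor \sum_{i\in S}\mathbb P(Z_{d(i)}\le k)+\tfrac12\right\rfloor$ for $k\ge 0$ and $N(-1)=0$. The model sequence $\mathbf d_H=(d_H(1),\dots,d_H(s))$ is the non-decreasing sequence in which each $k\ge0$ occurs exactly $N(k)-N(k-1)$ times. For a graph $G$ on $\{1,\dots,n\}$ let $\mathbf d_S=(d_S(1),\dots,d_S(s))$, where $d_S(k)$ is the degree of the vertex $i_k$ in the induced subgraph $G[S]$. For a sequence $\mathbf a$ let $n_i(\mathbf a)$ be the number of its entries equal to $i$. Write $x=y(1\pm\varepsilon)$ for $|x-y|\le\varepsilon y$. **Theorem.** For every constant $c>0$ there are constants $C,\delta_0>0$ and $M_0$,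 depending only on $c$, such that the following holds for all $n$, $\mathbf d$, $S$ as above and all $\delta\in(0,\delta_0]$ with $M\ge M_0$, $\gamma<1-c$ and $$\Delta^2(\gamma^{-1}\log M)^{12}\le\delta\, d(S).$$ There is a graph on $\{1,\dots,n\}$ in which each vertex $i$ has degree $d(i)$, and if $G$ is chosen uniformly at random among all such graphs, then with probability at least $1-C/\sqrt{\log M}$ all of the following hold: (a) for all $k$ with $d(i_k)\ge\delta^{1/32}J$: $d_S(k)=\gamma d(i_k)\,(1\pm 8\delta^{1/64})$ and $d_S(k)=d_H(k)\,(1\pm 12\delta^{1/64})$; (b) for all $k$ with $d(i_k)<\delta^{1/32}J$: $\max\{d_S(k),d_H(k)\}\le 2\gamma\delta^{1/32}J$; (c) for all integers $0\le i\le\tfrac12\gamma J$: $\displaystyle |n_i(\mathbf d_S)-n_i(\mathbf d_H)|\le\frac{\gamma\, n_i(\mathbf d_H)}{J^3}+\gamma J^5$. -/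

import Mathlib

namespace InducedDegrees

open Finset

/-- The total degree `d(A) = ∑_{v ∈ A} d(v)` of a vertex set `A`. -/
def totalDeg {n : ℕ} (d : Fin n → ℕ) (A : Finset (Fin n)) : ℕ := ∑ v ∈ A, d v

/-- The total degree `M = d([n])` of the whole sequence. -/
def totalM {n : ℕ} (d : Fin n → ℕ) : ℕ := totalDeg d univ

/-- The largest entry `Δ` of `d`. -/
def maxDeg {n : ℕ} (d : Fin n → ℕ) : ℕ := univ.sup d

/-- The density `γ = d(S) / M`. -/
noncomputable def gam {n : ℕ} (d : Fin n → ℕ) (S : Finset (Fin n)) : ℝ :=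
  (totalDeg d S : ℝ) / (totalM d : ℝ)

/-- The cut-off `J = δ^{-1/16} γ⁻¹ log M`. -/
noncomputable def cutoff {n : ℕ} (d : Fin n → ℕ) (S : Finset (Fin n)) (δ : ℝ) : ℝ :=
  δ ^ (-(1 / 16) : ℝ) * (gam d S)⁻¹ * Real.log (totalM d)

/-- `G` has degree sequence `d`: every vertex `v` has degree `d v`. -/
def HasDegrees {n : ℕ} (d : Fin n → ℕ) (G : SimpleGraph (Fin n)) : Prop :=
  ∀ v, (G.neighborSet v).ncard = d v

/-- The probability of the event `E` when `G` is uniformly random among all graphs on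
`Fin n` with degree sequence `d`. -/
noncomputable def prob {n : ℕ} (d : Fin n → ℕ) (E : SimpleGraph (Fin n) → Prop) : ℝ :=
  ({G | HasDegrees d G ∧ E G}.ncard : ℝ) / ({G | HasDegrees d G}.ncard : ℝ)

/-- The vertices of `S` in increasing order: `vtx S k` is `i_k` (with `k` counted from `0`). -/
def vtx {n : ℕ} (S : Finset (Fin n)) (k : Fin S.card) : Fin n := S.orderEmbOfFin rfl k

theorem vtx_mem {n : ℕ} (S : Finset (Fin n)) (k : Fin S.card) :
    vtx S k ∈ (S : Set (Fin n)) := S.orderEmbOfFin_mem rfl k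

/-- The degree sequence `d_S` of the induced subgraph `G[S]`: the entry `d_S(k)` is the degree
of the vertex `i_k` in `G[S]`. -/
noncomputable def inducedSeq {n : ℕ} (G : SimpleGraph (Fin n)) (S : Finset (Fin n))
    (k : Fin S.card) : ℕ :=
  ((G.induce (S : Set (Fin n))).neighborSet ⟨vtx S k, vtx_mem S k⟩).ncard

/-- `n_i(a)`: the number of entries of the sequence `a` that are equal to `i`. -/
def entryCount {s : ℕ} (a : Fin s → ℕ) (i : ℕ) : ℕ := (univ.filter fun k => a k = i).card

/-- `P(Z ≤ k)` for `Z` binomial with parameters `j` and `p`. -/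
noncomputable def binomCdf (j : ℕ) (p : ℝ) (k : ℕ) : ℝ :=
  ∑ i ∈ range (k + 1), (j.choose i : ℝ) * p ^ i * (1 - p) ^ (j - i)

/-- `N(k) = ⌊∑_{v ∈ S} P(Z_{d(v)} ≤ k) + 1/2⌋`, where `Z_j` is binomial with parameters `j`
and `γ`. -/
noncomputable def modelN {n : ℕ} (d : Fin n → ℕ) (S : Finset (Fin n)) (k : ℕ) : ℕ :=
  ⌊(∑ v ∈ S, binomCdf (d v) (gam d S) k) + 1 / 2⌋₊

/-- The model sequence `d_H`: the non-decreasing sequence of length `|S|` in which the value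
`0` occurs `N(0)` times and every `j ≥ 1` occurs `N(j) - N(j-1)` times. Its `k`-th entry
(counted from `0`) is the least `j` with `k < N(j)`; that this is the sequence just described
is `modelSeq_monotone`, `entryCount_modelSeq_zero` and `entryCount_modelSeq_succ`. -/
noncomputable def modelSeq {n : ℕ} (d : Fin n → ℕ) (S : Finset (Fin n))
    (k : Fin S.card) : ℕ :=
  sInf {j : ℕ | (k : ℕ) < modelN d S j}

theorem gam_nonneg {n : ℕ} (d : Fin n → ℕ) (S : Finset (Fin n)) : 0 ≤ gam d S := by
  unfold gam; positivity

theorem gam_le_one {n : ℕ} (d : Fin n → ℕ) (S : Finset (Fin n)) : gam d S ≤ 1 := by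
  unfold gam
  apply div_le_one_of_le₀ _ (by positivity)
  exact_mod_cast Finset.sum_le_sum_of_subset (f := d) (Finset.subset_univ S)

theorem binomCdf_mono (j : ℕ) {p : ℝ} (h0 : 0 ≤ p) (h1 : p ≤ 1) : Monotone (binomCdf j p) := by
  intro k l hkl
  have h2 : 0 ≤ 1 - p := by linarith
  apply Finset.sum_le_sum_of_subset_of_nonneg
  · exact Finset.range_mono (by omega)
  · intros; positivity

theorem binomCdf_eq_one (j : ℕ) (p : ℝ) {k : ℕ} (h : j ≤ k) : binomCdf j p k = 1 := by
  have h1 : binomCdf j p k = binomCdf j p j := by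
    unfold binomCdf
    symm
    apply Finset.sum_subset (Finset.range_mono (by omega))
    intro i _ hi
    have : j < i := by simpa using hi
    simp [Nat.choose_eq_zero_of_lt this]
  have h2 := add_pow p (1 - p) j
  rw [h1, binomCdf]
  rw [add_sub_cancel, one_pow] at h2
  refine Eq.trans ?_ h2.symm
  apply Finset.sum_congr rfl
  intros; ring

theorem modelN_mono {n : ℕ} (d : Fin n → ℕ) (S : Finset (Fin n)) : Monotone (modelN d S) := by
  intro k l hkl
  unfold modelN
  apply Nat.floor_mono
  gcongr with v
  exact binomCdf_mono _ (gam_nonneg d S) (gam_le_one d S) hkl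

theorem modelN_eq_card {n : ℕ} (d : Fin n → ℕ) (S : Finset (Fin n)) {k : ℕ}
    (h : maxDeg d ≤ k) : modelN d S k = S.card := by
  unfold modelN
  have : ∑ v ∈ S, binomCdf (d v) (gam d S) k = S.card := by
    rw [Finset.sum_congr rfl (fun v _ => binomCdf_eq_one (d v) (gam d S)
      ((Finset.le_sup (f := d) (Finset.mem_univ v)).trans h))]
    simp
  rw [this, Nat.floor_eq_iff (by positivity)]
  constructor <;> linarith

theorem modelN_le_card {n : ℕ} (d : Fin n → ℕ) (S : Finset (Fin n)) (k : ℕ) :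
    modelN d S k ≤ S.card := by
  rw [← modelN_eq_card d S (le_max_right k (maxDeg d))]
  exact modelN_mono d S (le_max_left _ _)

theorem modelSeq_le_iff {n : ℕ} (d : Fin n → ℕ) (S : Finset (Fin n)) (k : Fin S.card) (j : ℕ) :
    modelSeq d S k ≤ j ↔ (k : ℕ) < modelN d S j := by
  have hne : {j : ℕ | (k : ℕ) < modelN d S j}.Nonempty :=
    ⟨maxDeg d, by simp [modelN_eq_card d S le_rfl]⟩
  constructor
  · intro h
    have h1 : (k : ℕ) < modelN d S (modelSeq d S k) := Nat.sInf_mem hne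
    exact lt_of_lt_of_le h1 (modelN_mono d S h)
  · intro h
    exact Nat.sInf_le h

theorem modelSeq_monotone {n : ℕ} (d : Fin n → ℕ) (S : Finset (Fin n)) :
    Monotone (modelSeq d S) := by
  intro k l hkl
  rw [modelSeq_le_iff]
  exact lt_of_le_of_lt hkl ((modelSeq_le_iff d S l _).1 le_rfl)

theorem card_modelSeq_le {n : ℕ} (d : Fin n → ℕ) (S : Finset (Fin n)) (j : ℕ) :
    (univ.filter fun k => modelSeq d S k ≤ j).card = modelN d S j := by
  simp only [modelSeq_le_iff]
  rw [Fin.card_filter_val_lt]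
  exact min_eq_right (modelN_le_card d S j)

theorem entryCount_modelSeq_zero {n : ℕ} (d : Fin n → ℕ) (S : Finset (Fin n)) :
    entryCount (modelSeq d S) 0 = modelN d S 0 := by
  rw [← card_modelSeq_le]
  simp [entryCount]

theorem entryCount_modelSeq_succ {n : ℕ} (d : Fin n → ℕ) (S : Finset (Fin n)) (j : ℕ) :
    (entryCount (modelSeq d S) (j + 1) : ℤ) = modelN d S (j + 1) - modelN d S j := by
  rw [← card_modelSeq_le, ← card_modelSeq_le]
  have : (univ.filter fun k => modelSeq d S k ≤ j + 1).card =
      (univ.filter fun k => modelSeq d S k ≤ j).card + entryCount (modelSeq d S) (j + 1) := by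
    unfold entryCount
    rw [← Finset.card_union_of_disjoint]
    · congr 1
      ext k
      simp
      omega
    · rw [Finset.disjoint_filter]
      intros; omega
  omega

/-- The entries of `d_S` at vertices of large degree:
`d_S(k) = γ d(i_k) (1 ± 8 δ^{1/64}) = d_H(k) (1 ± 12 δ^{1/64})` whenever
`d(i_k) ≥ δ^{1/32} J`. Here `x = y (1 ± ε)` means `|x - y| ≤ ε y`. -/
def LargeDegrees {n : ℕ} (d : Fin n → ℕ) (S : Finset (Fin n)) (δ : ℝ)
    (G : SimpleGraph (Fin n)) : Prop :=
  ∀ k : Fin S.card, δ ^ (1 / 32 : ℝ) * cutoff d S δ ≤ (d (vtx S k) : ℝ) →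
    |(inducedSeq G S k : ℝ) - gam d S * d (vtx S k)|
        ≤ 8 * δ ^ (1 / 64 : ℝ) * (gam d S * d (vtx S k)) ∧
    |(inducedSeq G S k : ℝ) - modelSeq d S k|
        ≤ 12 * δ ^ (1 / 64 : ℝ) * (modelSeq d S k : ℝ)

/-- The remaining entries: `max {d_S(k), d_H(k)} ≤ 2 γ δ^{1/32} J` whenever
`d(i_k) < δ^{1/32} J`. -/
def SmallDegrees {n : ℕ} (d : Fin n → ℕ) (S : Finset (Fin n)) (δ : ℝ)
    (G : SimpleGraph (Fin n)) : Prop :=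
  ∀ k : Fin S.card, (d (vtx S k) : ℝ) < δ ^ (1 / 32 : ℝ) * cutoff d S δ →
    max (inducedSeq G S k : ℝ) (modelSeq d S k : ℝ)
      ≤ 2 * gam d S * δ ^ (1 / 32 : ℝ) * cutoff d S δ

/-- The counts: `|n_i(d_S) - n_i(d_H)| ≤ γ n_i(d_H) / J³ + γ J⁵` for all `i ≤ γ J / 2`. -/
def CloseCounts {n : ℕ} (d : Fin n → ℕ) (S : Finset (Fin n)) (δ : ℝ)
    (G : SimpleGraph (Fin n)) : Prop :=
  ∀ i : ℕ, (i : ℝ) ≤ 1 / 2 * gam d S * cutoff d S δ →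
    |(entryCount (inducedSeq G S) i : ℝ) - entryCount (modelSeq d S) i|
      ≤ gam d S * entryCount (modelSeq d S) i / cutoff d S δ ^ 3 + gam d S * cutoff d S δ ^ 5

end InducedDegrees

/-! The number of neighbours in `S` of a vertex `v` of degree `D` is nearly Bin(D, γ). To see this,
replace edges `vu`, `wx` by `vw`, `ux`, with `u` in `S` and `w` outside: `v` loses one neighbour in
`S`. Counting such switchings from both ends, with about (k+1)(1-γ)M ways down and (D-k)γM ways up,
gives the ratio of consecutive fibre sizes up to a relative error ε = O(Δ²/(min(γ, 1-γ)M))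
(`nearBinom_fiberCount`). These are the binomial ratios. Chaining them compares the distribution
with the binomial up to (1-ε)^D (`NearBinom.le_binomPmf`, `NearBinom.binomPmf_le`); used as
geometric decay they bound the tails for every D (`NearBinom.upper_tail`, `NearBinom.lower_tail`).

Tail bounds of size M⁻³ and a union bound over `S` show that almost surely no vertex is `Atypical`.
The same bounds locate the entries of the model sequence (`modelSeq_le`, `le_modelSeq`), because `d`
is monotone and all but the first or last few summands of N(j) are nearly 0 or 1. This settles (a)
and (b).

For the counts in (c), vertices of degree above J have too many neighbours in `S` to matter when i ≤
γJ/2. For the others (1-ε)^D is 1-O(J⁻¹¹), so first moments are accurate. Second moments need two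
vertices to be nearly independent: condition on whether they are adjacent and on the neighbourhood
of one of them, and switch at the other without touching the first (`GoodError.card_joint_le`).
Adjacency itself is rare (`card_adj_le`), so it contributes little (`GoodError.card_pair_le`).
Chebyshev's inequality and a union bound over i give (c), since the model count differs from the
binomial mean only by rounding (`abs_entryCount_modelSeq_sub_le`).

Existence of a graph with the given degrees comes from an extremal argument (`graphs_nonempty`). -/

namespace InducedDegrees
open Finset

/-! ### Switchings along 4-cycles and how many of them there are. -/

section Switching

variable {V : Type*}

/-- The graph obtained from `G` by flipping the edges of the cycle `v u x w`. -/
def flip (G : SimpleGraph V) (v u w x : V) : SimpleGraph V where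
  Adj a b := a ≠ b ∧ Xor (G.Adj a b)
    (s(a, b) = s(v, u) ∨ s(a, b) = s(u, x) ∨ s(a, b) = s(x, w) ∨ s(a, b) = s(w, v))
  symm := ⟨by
    intro a b h
    rw [Sym2.eq_swap (a := b), G.adj_comm b a]
    exact ⟨h.1.symm, h.2⟩⟩
  loopless := ⟨fun a h => h.1 rfl⟩

/-- The edges `vu`, `wx` of `G` can be replaced by `vw`, `ux`. -/
def Switchable (G : SimpleGraph V) (v u w x : V) : Prop :=
  G.Adj v u ∧ G.Adj w x ∧ ¬ G.Adj v w ∧ ¬ G.Adj u x ∧ v ≠ w ∧ u ≠ x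

/-- Reflecting or rotating the 4-cycle leaves its edge set unchanged. With these symmetries a
neighbourhood computation at `v` transfers to the other three corners. -/
theorem flip_comm (G : SimpleGraph V) (v u w x : V) : flip G v u w x = flip G v w u x := by
  ext a b
  simp only [flip, Sym2.eq_swap (a := u) (b := x), Sym2.eq_swap (a := u) (b := v),
    Sym2.eq_swap (a := w) (b := v), Sym2.eq_swap (a := w) (b := x)]
  have : (s(a, b) = s(v, u) ∨ s(a, b) = s(x, u) ∨ s(a, b) = s(x, w) ∨ s(a, b) = s(v, w)) ↔
    (s(a, b) = s(v, w) ∨ s(a, b) = s(x, w) ∨ s(a, b) = s(x, u) ∨ s(a, b) = s(v, u)) := by tauto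
  rw [this]

theorem flip_rotate (G : SimpleGraph V) (v u w x : V) : flip G v u w x = flip G u x v w := by
  ext a b
  simp only [flip]
  have : (s(a, b) = s(v, u) ∨ s(a, b) = s(u, x) ∨ s(a, b) = s(x, w) ∨ s(a, b) = s(w, v)) ↔
    (s(a, b) = s(u, x) ∨ s(a, b) = s(x, w) ∨ s(a, b) = s(w, v) ∨ s(a, b) = s(v, u)) := by tauto
  rw [this]

theorem flip_flip (G : SimpleGraph V) (v u w x : V) : flip (flip G v u w x) v u w x = G := by
  ext a b
  simp only [flip, xor_def]
  have : G.Adj a b → a ≠ b := G.ne_of_adj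
  tauto

variable {G : SimpleGraph V} {v u w x : V}

theorem Switchable.symm_left (h : Switchable G v u w x) : Switchable G u v x w :=
  ⟨h.1.symm, h.2.1.symm, h.2.2.2.1, h.2.2.1, h.2.2.2.2.2, h.2.2.2.2.1⟩

theorem Switchable.symm_right (h : Switchable G v u w x) : Switchable G w x v u :=
  ⟨h.2.1, h.1, fun e => h.2.2.1 e.symm, fun e => h.2.2.2.1 e.symm, h.2.2.2.2.1.symm,
    h.2.2.2.2.2.symm⟩

theorem flip_eq_symm_left : flip G v u w x = flip G u v x w := by
  rw [flip_rotate, flip_comm]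

theorem flip_eq_symm_right : flip G v u w x = flip G w x v u := by
  rw [flip_comm, flip_rotate, flip_comm, flip_comm]

/-- Opposite corners are distinct as well: if v = x or u = w, then the required non-edge `vw` would
be one of the given edges. -/
theorem Switchable.ne (h : Switchable G v u w x) :
    v ≠ u ∧ w ≠ x ∧ v ≠ w ∧ u ≠ x ∧ v ≠ x ∧ u ≠ w := by
  obtain ⟨h1, h2, h3, h4, h5, h6⟩ := h
  refine ⟨h1.ne, h2.ne, h5, h6, ?_, ?_⟩
  · rintro rfl; exact h3 h2.symm
  · rintro rfl; exact h3 h1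

variable [Fintype V]

open Classical in
/-- The neighbours of `v` in `G` as a finset. -/
noncomputable def nb (G : SimpleGraph V) (v : V) : Finset V := univ.filter fun w => G.Adj v w

@[simp] theorem mem_nb {G : SimpleGraph V} {v w : V} : w ∈ nb G v ↔ G.Adj v w := by
  simp [nb]

theorem nb_flip_of_ne {y : V} (h1 : y ≠ v) (h2 : y ≠ u) (h3 : y ≠ w) (h4 : y ≠ x) :
    nb (flip G v u w x) y = nb G y := by
  ext b
  simp only [mem_nb, flip, xor_def, Sym2.eq_iff]
  have : G.Adj y b → y ≠ b := G.ne_of_adj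
  grind

variable [DecidableEq V]

theorem Switchable.nb_flip (h : Switchable G v u w x) :
    nb (flip G v u w x) v = insert w ((nb G v).erase u) := by
  obtain ⟨n1, n2, n3, n4, n5, n6⟩ := h.ne
  obtain ⟨h1, h2, h3, h4, h5, h6⟩ := h
  ext b
  simp only [mem_nb, flip, mem_insert, mem_erase, xor_def, Sym2.eq_iff]
  have : G.Adj v b → v ≠ b := G.ne_of_adj
  by_cases hb : b = w
  · subst hb; simp [*]
  by_cases hb : b = u
  · subst hb; simp [*]
  grind

theorem Switchable.nb_flip_u (h : Switchable G v u w x) :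
    nb (flip G v u w x) u = insert x ((nb G u).erase v) := by
  rw [flip_eq_symm_left]; exact h.symm_left.nb_flip

theorem Switchable.nb_flip_w (h : Switchable G v u w x) :
    nb (flip G v u w x) w = insert v ((nb G w).erase x) := by
  rw [flip_eq_symm_right]; exact h.symm_right.nb_flip

theorem Switchable.nb_flip_x (h : Switchable G v u w x) :
    nb (flip G v u w x) x = insert u ((nb G x).erase w) := by
  rw [flip_eq_symm_left]; exact h.symm_left.nb_flip_w

theorem Switchable.card_nb_flip (h : Switchable G v u w x) (y : V) :
    (nb (flip G v u w x) y).card = (nb G y).card := by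
  have key : ∀ (s : Finset V) (a b : V), a ∈ s → b ∉ s → (insert b (s.erase a)).card = s.card := by
    intro s a b ha hb
    rw [card_insert_of_notMem (fun h => hb (mem_of_mem_erase h)), card_erase_add_one ha]
  obtain ⟨h1, h2, h3, h4, h5, h6⟩ := id h
  by_cases e1 : y = v
  · subst e1; rw [h.nb_flip]; exact key _ _ _ (by simpa) (by simpa)
  by_cases e2 : y = u
  · subst e2; rw [h.nb_flip_u]; exact key _ _ _ (by simpa using h1.symm) (by simpa)
  by_cases e3 : y = w
  · subst e3; rw [h.nb_flip_w]
    exact key _ _ _ (by simpa) (by simpa [G.adj_comm] using h3)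
  by_cases e4 : y = x
  · subst e4; rw [h.nb_flip_x]
    exact key _ _ _ (by simpa using h2.symm) (by simpa [G.adj_comm] using h4)
  rw [nb_flip_of_ne e1 e2 e3 e4]

theorem Switchable.flip (h : Switchable G v u w x) : Switchable (flip G v u w x) v w u x := by
  obtain ⟨n1, n2, n3, n4, n5, n6⟩ := h.ne
  have hv := h.nb_flip
  have hx := h.nb_flip_x
  refine ⟨?_, ?_, ?_, ?_, n1, n2⟩
  · rw [← mem_nb, hv]; simp
  · rw [SimpleGraph.adj_comm, ← mem_nb, hx]; simp
  · rw [← mem_nb, hv]; simp [n6]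
  · rw [SimpleGraph.adj_comm, ← mem_nb, hx]; simp [n6.symm]

open Classical in
/-- The triples `(u, w, x) ∈ U × W × X` for which `vu`, `wx` can be replaced by `vw`, `ux`. -/
noncomputable def switches (G : SimpleGraph V) (v : V) (U W X : Finset V) :
    Finset (V × V × V) :=
  univ.filter fun t => t.1 ∈ U ∧ t.2.1 ∈ W ∧ t.2.2 ∈ X ∧ Switchable G v t.1 t.2.1 t.2.2

/-- A switching is undone by the switching with `u` and `w` exchanged, so recording the new graph
together with the exchanged triple is injective. This is the double count behind every ratio
estimate below; it is applied in both directions. -/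
theorem sum_switches_le (A B : Finset (SimpleGraph V)) (v : V) (U W X : Finset V)
    (hAB : ∀ G ∈ A, ∀ u ∈ U, ∀ w ∈ W, ∀ x ∈ X, Switchable G v u w x →
      InducedDegrees.flip G v u w x ∈ B) :
    ∑ G ∈ A, (switches G v U W X).card ≤ ∑ G ∈ B, (switches G v W U X).card := by
  classical
  rw [← card_sigma, ← card_sigma]
  refine card_le_card_of_injOn
    (fun p => ⟨InducedDegrees.flip p.1 v p.2.1 p.2.2.1 p.2.2.2, p.2.2.1, p.2.1, p.2.2.2⟩) ?_ ?_
  · rintro ⟨G, u, w, x⟩ h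
    simp only [coe_sigma, Set.mem_sigma_iff, mem_coe, switches, mem_filter, mem_univ,
      true_and] at h ⊢
    obtain ⟨hG, hu, hw, hx, hs⟩ := h
    exact ⟨hAB G hG u hu w hw x hx hs, hw, hu, hx, hs.flip⟩
  · rintro ⟨G, u, w, x⟩ _ ⟨G', u', w', x'⟩ _ h
    simp only [Sigma.mk.injEq, heq_eq_eq, Prod.mk.injEq] at h
    obtain ⟨h, rfl, rfl, rfl⟩ := h
    have := congrArg (fun H => InducedDegrees.flip H v u w x) h
    simp only [flip_flip] at this
    rw [this]

open Classical in
theorem card_pairs (G : SimpleGraph V) (W : Finset V) :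
    (univ.filter fun p : V × V => p.1 ∈ W ∧ G.Adj p.1 p.2).card = ∑ w ∈ W, (nb G w).card := by
  rw [← card_sigma]
  refine card_nbij' (fun p => ⟨p.1, p.2⟩) (fun p => (p.1, p.2)) ?_ ?_ ?_ ?_ <;>
    simp [Set.MapsTo, Set.LeftInvOn]

open Classical in
theorem card_pairs_swap (G : SimpleGraph V) (W : Finset V) :
    (univ.filter fun p : V × V => p.2 ∈ W ∧ G.Adj p.1 p.2).card = ∑ w ∈ W, (nb G w).card := by
  rw [← card_pairs]
  refine card_nbij' Prod.swap Prod.swap ?_ ?_ ?_ ?_ <;>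
    simp [Set.MapsTo, Set.LeftInvOn, G.adj_comm]

theorem card_switches_le (G : SimpleGraph V) (v : V) (U W X : Finset V) :
    (switches G v U W X).card ≤ (nb G v ∩ U).card * ∑ w ∈ W, (nb G w).card := by
  classical
  rw [← card_pairs, ← card_product]
  apply card_le_card
  rintro ⟨u, w, x⟩ h
  simp only [switches, mem_filter, mem_univ, true_and] at h
  simp only [mem_product, mem_inter, mem_nb, mem_filter, mem_univ, true_and]
  exact ⟨⟨h.2.2.2.1, h.1⟩, h.2.1, h.2.2.2.2.1⟩

/-- Fix `u`. An oriented edge (w, x) starting in `W` fails only if `w` is `v` or a neighbour of `v`,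
or `x` is `u`, a neighbour of `u`, or outside `X`. Every such vertex lies on at most `m` edges. -/
theorem le_card_switches (G : SimpleGraph V) (v : V) (U W X : Finset V) (m : ℕ)
    (hm : ∀ y, (nb G y).card ≤ m) :
    (nb G v ∩ U).card * ∑ w ∈ W, (nb G w).card ≤
      (switches G v U W X).card + (nb G v ∩ U).card * ((2 * (m + 1) + Xᶜ.card) * m) := by
  classical
  have hcard : (switches G v U W X).card = ∑ u ∈ nb G v ∩ U,
      (univ.filter fun p : V × V =>
        p.1 ∈ W ∧ p.2 ∈ X ∧ Switchable G v u p.1 p.2).card := by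
    rw [← card_sigma]
    refine card_nbij' (fun p => ⟨p.1, p.2⟩) (fun p => (p.1, p.2)) ?_ ?_
      (fun _ _ => rfl) (fun _ _ => rfl)
    · rintro ⟨u, w, x⟩ h
      simp only [switches, coe_filter, mem_univ, true_and, Set.mem_ofPred_eq] at h
      simp only [coe_sigma, Set.mem_sigma_iff, coe_filter, mem_univ, true_and, Set.mem_ofPred_eq,
        mem_coe, mem_inter, mem_nb]
      exact ⟨⟨h.2.2.2.1, h.1⟩, h.2.1, h.2.2.1, h.2.2.2⟩
    · rintro ⟨u, w, x⟩ h
      simp only [coe_sigma, Set.mem_sigma_iff, coe_filter, mem_univ, true_and, Set.mem_ofPred_eq,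
        mem_coe, mem_inter, mem_nb] at h
      simp only [switches, coe_filter, mem_univ, true_and, Set.mem_ofPred_eq]
      exact ⟨h.1.2, h.2.1, h.2.2.1, h.2.2.2⟩
  have hsum : ∀ A : Finset V, ∑ w ∈ A, (nb G w).card ≤ A.card * m := fun A => by
    simpa using sum_le_card_nsmul A _ m (fun y _ => hm y)
  have hins : ∀ y, (insert y (nb G y)).card ≤ m + 1 := fun y =>
    (card_insert_le _ _).trans (by have := hm y; omega)
  rw [hcard]
  simp only [← smul_eq_mul (a := (nb G v ∩ U).card), ← sum_const]
  rw [← sum_add_distrib]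
  apply sum_le_sum
  intro u hu
  have hu' : G.Adj v u := by simpa using (mem_inter.1 hu).1
  rw [← card_pairs]
  have hsub : (univ.filter fun p : V × V => p.1 ∈ W ∧ G.Adj p.1 p.2) ⊆
      (univ.filter fun p : V × V => p.1 ∈ W ∧ p.2 ∈ X ∧ Switchable G v u p.1 p.2) ∪
      ((univ.filter fun p : V × V => p.1 ∈ insert v (nb G v) ∧ G.Adj p.1 p.2) ∪
      (univ.filter fun p : V × V => p.2 ∈ insert u (nb G u) ∪ Xᶜ ∧ G.Adj p.1 p.2)) := by
    rintro ⟨w, x⟩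
    simp only [mem_filter, mem_union, mem_univ, true_and, mem_insert, mem_nb, mem_compl,
      Switchable]
    grind
  refine (card_le_card hsub).trans ((card_union_le _ _).trans ?_)
  gcongr
  refine (card_union_le _ _).trans ?_
  rw [card_pairs, card_pairs_swap]
  have h1 := hsum (insert v (nb G v))
  have h2 := hsum (insert u (nb G u) ∪ Xᶜ)
  have h3 : (insert u (nb G u) ∪ Xᶜ).card ≤ (m + 1) + Xᶜ.card :=
    (card_union_le _ _).trans (by have := hins u; omega)
  calc _ ≤ (m + 1) * m + ((m + 1) + Xᶜ.card) * m :=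
        Nat.add_le_add (h1.trans (Nat.mul_le_mul_right _ (hins v)))
          (h2.trans (Nat.mul_le_mul_right _ h3))
    _ = _ := by ring

end Switching
-- Sequences whose consecutive ratios are almost binomial.
/-- The weights of the binomial distribution. -/
noncomputable def binomPmf (D : ℕ) (γ : ℝ) (k : ℕ) : ℝ :=
  (D.choose k : ℝ) * γ ^ k * (1 - γ) ^ (D - k)

/-- The sequence `p`, supported on `{0, …, D}`, has up to factors `1 - ε` the same ratios of
consecutive terms as the binomial distribution with parameters `D` and `γ`. -/
structure NearBinom (D : ℕ) (γ ε : ℝ) (p : ℕ → ℝ) : Prop where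
  nonneg : ∀ k, 0 ≤ p k
  support : ∀ k, D < k → p k = 0
  up : ∀ k < D, ((k : ℝ) + 1) * (1 - γ) * (1 - ε) * p (k + 1) ≤ ((D : ℝ) - k) * γ * p k
  down : ∀ k < D, ((D : ℝ) - k) * γ * (1 - ε) * p k ≤ ((k : ℝ) + 1) * (1 - γ) * p (k + 1)

theorem binomPmf_pos {D : ℕ} {γ : ℝ} (h0 : 0 < γ) (h1 : γ < 1) {k : ℕ} (hk : k ≤ D) :
    0 < binomPmf D γ k := by
  have : 0 < D.choose k := Nat.choose_pos hk
  have : 0 < 1 - γ := by linarith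
  unfold binomPmf
  positivity

theorem binomPmf_nonneg (D : ℕ) {γ : ℝ} (h0 : 0 ≤ γ) (h1 : γ ≤ 1) (k : ℕ) :
    0 ≤ binomPmf D γ k := by
  have : 0 ≤ 1 - γ := by linarith
  unfold binomPmf
  positivity

theorem binomPmf_eq_zero {D : ℕ} (γ : ℝ) {k : ℕ} (hk : D < k) : binomPmf D γ k = 0 := by
  simp [binomPmf, Nat.choose_eq_zero_of_lt hk]

theorem binomPmf_ratio {D : ℕ} (γ : ℝ) {k : ℕ} (hk : k < D) :
    ((k : ℝ) + 1) * (1 - γ) * binomPmf D γ (k + 1) = ((D : ℝ) - k) * γ * binomPmf D γ k := by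
  unfold binomPmf
  have h : ((D.choose (k + 1) : ℕ) : ℝ) * (k + 1) = D.choose k * ((D : ℝ) - k) := by
    have := Nat.choose_succ_right_eq D k
    rw [← Nat.cast_sub hk.le]
    exact_mod_cast this
  obtain ⟨m, rfl⟩ := Nat.exists_eq_add_of_lt hk
  have e1 : k + m + 1 - (k + 1) = m := by omega
  have e2 : k + m + 1 - k = m + 1 := by omega
  rw [e1, e2]
  calc _ = (((k + m + 1).choose (k + 1) : ℕ) : ℝ) * (k + 1) * (γ ^ (k + 1) * (1 - γ) ^ (m + 1)) := by
        ring
    _ = _ := by rw [h]; ring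

/-- Size biasing: this compares the law of the remaining neighbours, once one neighbour in `S` is
fixed, with the unconditioned law. It is needed for adjacent pairs. -/
theorem binomPmf_succ_succ {D : ℕ} {γ : ℝ} (hγ : 0 < γ) (k : ℕ) :
    binomPmf D γ k = ((k : ℝ) + 1) / (((D : ℝ) + 1) * γ) * binomPmf (D + 1) γ (k + 1) := by
  unfold binomPmf
  have h : ((D : ℝ) + 1) * D.choose k = (D + 1).choose (k + 1) * ((k : ℝ) + 1) := by
    exact_mod_cast Nat.add_one_mul_choose_eq D k
  have e : D + 1 - (k + 1) = D - k := by omega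
  rw [e, div_mul_eq_mul_div, eq_div_iff (by positivity)]
  calc _ = ((D : ℝ) + 1) * D.choose k * (γ ^ (k + 1) * (1 - γ) ^ (D - k)) := by ring
    _ = _ := by rw [h]; ring

theorem sum_binomPmf (D : ℕ) (γ : ℝ) : ∑ k ∈ range (D + 1), binomPmf D γ k = 1 :=
  binomCdf_eq_one D γ le_rfl

theorem nearBinom_binomPmf (D : ℕ) {γ : ℝ} (h0 : 0 ≤ γ) (h1 : γ ≤ 1) :
    NearBinom D γ 0 (binomPmf D γ) where
  nonneg := binomPmf_nonneg D h0 h1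
  support k hk := binomPmf_eq_zero γ hk
  up k hk := by rw [sub_zero, mul_one, binomPmf_ratio γ hk]
  down k hk := by rw [sub_zero, mul_one, binomPmf_ratio γ hk]

namespace NearBinom

variable {D : ℕ} {γ ε : ℝ} {p : ℕ → ℝ}

theorem single_le_sum (h : NearBinom D γ ε p) (k : ℕ) : p k ≤ ∑ j ∈ range (D + 1), p j := by
  by_cases hk : k ≤ D
  · exact Finset.single_le_sum (fun j _ => h.nonneg j) (by simp; omega)
  · rw [h.support k (by omega)]
    exact sum_nonneg fun j _ => h.nonneg j

/-- The quotients `p k / b k` vary by a factor `(1 - ε) ^ m` over `m` steps. -/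
theorem step (h : NearBinom D γ ε p) (h0 : 0 < γ) (h1 : γ < 1) (hε : ε ≤ 1) (m : ℕ) : ∀ k, k + m ≤ D →
    (1 - ε) ^ m * p (k + m) * binomPmf D γ k ≤ p k * binomPmf D γ (k + m) ∧
    (1 - ε) ^ m * p k * binomPmf D γ (k + m) ≤ p (k + m) * binomPmf D γ k := by
  have hε' : 0 ≤ 1 - ε := by linarith
  induction m with
  | zero => intro k hk; simp
  | succ m ih =>
    intro k hk
    obtain ⟨i1, i2⟩ := ih k (by omega)
    have hlt : k + m < D := by omega
    have u := h.up (k + m) hlt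
    have l := h.down (k + m) hlt
    have r := binomPmf_ratio γ hlt
    have bk := binomPmf_pos h0 h1 (show k ≤ D by omega)
    have bm := binomPmf_pos h0 h1 (show k + m ≤ D by omega)
    have bm' := binomPmf_pos h0 h1 (show k + m + 1 ≤ D by omega)
    have hA : 0 < (((k + m : ℕ) : ℝ) + 1) * (1 - γ) :=
      mul_pos (by positivity) (by linarith)
    set A := (((k + m : ℕ) : ℝ) + 1) * (1 - γ)
    set B := ((D : ℝ) - (k + m : ℕ)) * γ
    have hB : 0 < B := mul_pos (by
      have : ((k + m : ℕ) : ℝ) < D := by exact_mod_cast hlt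
      linarith) h0
    rw [← add_assoc]
    set b := binomPmf D γ k
    set b1 := binomPmf D γ (k + m)
    set b2 := binomPmf D γ (k + m + 1)
    have hpk := h.nonneg k
    have hp1 := h.nonneg (k + m)
    have hp2 := h.nonneg (k + m + 1)
    have key1 : (1 - ε) * p (k + m + 1) * b1 ≤ p (k + m) * b2 := by
      refine le_of_mul_le_mul_left ?_ hA
      calc A * ((1 - ε) * p (k + m + 1) * b1) = (A * (1 - ε) * p (k + m + 1)) * b1 := by ring
        _ ≤ (B * p (k + m)) * b1 := by gcongr
        _ = p (k + m) * (B * b1) := by ring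
        _ = A * (p (k + m) * b2) := by rw [← r]; ring
    have key2 : (1 - ε) * p (k + m) * b2 ≤ p (k + m + 1) * b1 := by
      refine le_of_mul_le_mul_left ?_ hA
      calc A * ((1 - ε) * p (k + m) * b2) = (1 - ε) * p (k + m) * (A * b2) := by ring
        _ = (B * (1 - ε) * p (k + m)) * b1 := by rw [r]; ring
        _ ≤ (A * p (k + m + 1)) * b1 := by gcongr
        _ = A * (p (k + m + 1) * b1) := by ring
    have hpow : 0 ≤ (1 - ε) ^ m := by positivity
    constructor
    · refine le_of_mul_le_mul_left ?_ bm
      calc b1 * ((1 - ε) ^ (m + 1) * p (k + m + 1) * b)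
          = (1 - ε) ^ m * b * ((1 - ε) * p (k + m + 1) * b1) := by ring
        _ ≤ (1 - ε) ^ m * b * (p (k + m) * b2) := by gcongr
        _ = ((1 - ε) ^ m * p (k + m) * b) * b2 := by ring
        _ ≤ (p k * b1) * b2 := by gcongr
        _ = _ := by ring
    · refine le_of_mul_le_mul_left ?_ bm
      calc b1 * ((1 - ε) ^ (m + 1) * p k * b2)
          = (1 - ε) * b2 * ((1 - ε) ^ m * p k * b1) := by ring
        _ ≤ (1 - ε) * b2 * (p (k + m) * b) := by gcongr
        _ = ((1 - ε) * p (k + m) * b2) * b := by ring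
        _ ≤ (p (k + m + 1) * b1) * b := by gcongr
        _ = _ := by ring

theorem ratio (h : NearBinom D γ ε p) (h0 : 0 < γ) (h1 : γ < 1) (hε0 : 0 ≤ ε) (hε : ε ≤ 1)
    {j k : ℕ} (hj : j ≤ D) (hk : k ≤ D) :
    (1 - ε) ^ D * p k * binomPmf D γ j ≤ p j * binomPmf D γ k := by
  have hε' : 0 ≤ 1 - ε := by linarith
  have key : ∀ m ≤ D, (1 - ε) ^ D * p k * binomPmf D γ j ≤ (1 - ε) ^ m * p k * binomPmf D γ j := by
    intro m hm
    have := binomPmf_nonneg D h0.le h1.le j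
    have := h.nonneg k
    gcongr ?_ * _ * _
    exact pow_le_pow_of_le_one hε' (by linarith) hm
  rcases le_total j k with hjk | hjk
  · obtain ⟨m, rfl⟩ := Nat.exists_eq_add_of_le hjk
    exact (key m (by omega)).trans (h.step h0 h1 hε m j hk).1
  · obtain ⟨m, rfl⟩ := Nat.exists_eq_add_of_le hjk
    exact (key m (by omega)).trans (h.step h0 h1 hε m k hj).2

/-- Summing the ratio comparison over `j` normalises it, because the binomial weights sum to 1. The
companion bound `binomPmf_le` is obtained by summing over the other index. -/
theorem le_binomPmf (h : NearBinom D γ ε p) (h0 : 0 < γ) (h1 : γ < 1) (hε0 : 0 ≤ ε) (hε : ε ≤ 1)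
    (k : ℕ) : (1 - ε) ^ D * p k ≤ binomPmf D γ k * ∑ j ∈ range (D + 1), p j := by
  by_cases hk : k ≤ D
  · calc _ = ∑ j ∈ range (D + 1), (1 - ε) ^ D * p k * binomPmf D γ j := by
          rw [← mul_sum, sum_binomPmf, mul_one]
      _ ≤ ∑ j ∈ range (D + 1), p j * binomPmf D γ k :=
          sum_le_sum fun j hj => h.ratio h0 h1 hε0 hε (by simp at hj; omega) hk
      _ = _ := by rw [← sum_mul, mul_comm]
  · rw [h.support k (by omega), binomPmf_eq_zero γ (by omega : D < k)]
    simp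

theorem binomPmf_le (h : NearBinom D γ ε p) (h0 : 0 < γ) (h1 : γ < 1) (hε0 : 0 ≤ ε) (hε : ε ≤ 1)
    (k : ℕ) : (1 - ε) ^ D * (binomPmf D γ k * ∑ j ∈ range (D + 1), p j) ≤ p k := by
  by_cases hk : k ≤ D
  · calc _ = ∑ j ∈ range (D + 1), (1 - ε) ^ D * p j * binomPmf D γ k := by
          rw [← sum_mul, ← mul_sum]; ring
      _ ≤ ∑ j ∈ range (D + 1), p k * binomPmf D γ j :=
          sum_le_sum fun j hj => h.ratio h0 h1 hε0 hε hk (by simp at hj; omega)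
      _ = _ := by rw [← mul_sum, sum_binomPmf, mul_one]
  · rw [h.support k (by omega), binomPmf_eq_zero γ (by omega : D < k)]
    simp

/-! ### Exponential tails from geometric decay of the ratios. -/

section Tails

variable {B η : ℝ}

/-- For j ≥ γB ≥ γD one has (D-j)γ ≤ γB(1-γ), so the ratio is at most 1/((1+η)(1-ε)), which is at
most 1-η/2. The bound `B` is kept separate from `D` so that one threshold serves all vertices of
degree at most `B`. -/
theorem succ_le_mul (h : NearBinom D γ ε p) (h0 : 0 < γ) (h1 : γ < 1) (hη0 : 0 < η)
    (hη : η ≤ 1 / 2) (hε : ε ≤ η / 8) (hDB : (D : ℝ) ≤ B) {j : ℕ}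
    (hj : (1 + η) * (γ * B) ≤ j) : p (j + 1) ≤ (1 - η / 2) * p j := by
  have hp := h.nonneg j
  have hq : 0 ≤ 1 - η / 2 := by linarith
  by_cases hjD : j < D
  swap
  · rw [h.support (j + 1) (by omega)]
    positivity
  have u := h.up j hjD
  have hB : 0 ≤ γ * B := mul_nonneg h0.le ((Nat.cast_nonneg D).trans hDB)
  have hA : 0 < ((j : ℝ) + 1) * (1 - γ) * (1 - ε) :=
    mul_pos (mul_pos (by positivity) (by linarith)) (by linarith)
  refine le_of_mul_le_mul_left ?_ hA
  calc _ ≤ ((D : ℝ) - j) * γ * p j := u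
    _ ≤ ((1 - η / 2) * (((j : ℝ) + 1) * (1 - γ) * (1 - ε))) * p j := by
      refine mul_le_mul_of_nonneg_right ?_ hp
      have e1 : (1 : ℝ) ≤ (1 - η / 2) * (1 + η) * (1 - ε) := by
        have : 1 + η / 4 ≤ (1 - η / 2) * (1 + η) := by nlinarith
        calc (1 : ℝ) ≤ (1 + η / 4) * (1 - η / 8) := by nlinarith
          _ ≤ _ := by gcongr; nlinarith
      have e2 : ((D : ℝ) - j) * γ ≤ γ * B * (1 - γ) := by
        have : γ * B ≤ j := by nlinarith
        calc ((D : ℝ) - j) * γ ≤ (B - γ * B) * γ := by gcongr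
          _ = _ := by ring
      have e3 : (1 + η) * (γ * B) ≤ (j : ℝ) + 1 := by linarith
      have hγ : 0 < 1 - γ := by linarith
      calc ((D : ℝ) - j) * γ ≤ 1 * (γ * B * (1 - γ)) := by linarith
        _ ≤ ((1 - η / 2) * (1 + η) * (1 - ε)) * (γ * B * (1 - γ)) := by gcongr
        _ = ((1 - η / 2) * (1 - γ) * (1 - ε)) * ((1 + η) * (γ * B)) := by ring
        _ ≤ ((1 - η / 2) * (1 - γ) * (1 - ε)) * ((j : ℝ) + 1) := by
          have : 0 ≤ 1 - ε := by linarith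
          gcongr
        _ = _ := by ring
    _ = _ := by ring

theorem le_mul_succ (h : NearBinom D γ ε p) (h0 : 0 < γ) (h1 : γ < 1) (hη0 : 0 < η)
    (hη : η ≤ 1 / 2) (hε : ε ≤ η / 8) (hDB : B ≤ D) {j : ℕ}
    (hj : (j : ℝ) + 1 ≤ (1 - η) * (γ * B)) : p j ≤ (1 - η / 2) * p (j + 1) := by
  have hp := h.nonneg (j + 1)
  have hq : 0 ≤ 1 - η / 2 := by linarith
  have hB : 0 < γ * B := by
    by_contra hcon
    have : (1 - η) * (γ * B) ≤ 0 := mul_nonpos_of_nonneg_of_nonpos (by linarith) (by linarith)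
    have : (0 : ℝ) ≤ j := Nat.cast_nonneg j
    linarith
  have hB' : 0 < B := pos_of_mul_pos_right hB h0.le
  have hjB : (j : ℝ) ≤ γ * B := by nlinarith
  have hjD : j < D := by
    have : (j : ℝ) < D := by nlinarith
    exact_mod_cast this
  have l := h.down j hjD
  have hA : 0 < ((D : ℝ) - j) * γ * (1 - ε) := by
    refine mul_pos (mul_pos ?_ h0) (by linarith)
    have : (j : ℝ) < D := by exact_mod_cast hjD
    linarith
  refine le_of_mul_le_mul_left ?_ hA
  calc _ ≤ ((j : ℝ) + 1) * (1 - γ) * p (j + 1) := l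
    _ ≤ ((1 - η / 2) * (((D : ℝ) - j) * γ * (1 - ε))) * p (j + 1) := by
      refine mul_le_mul_of_nonneg_right ?_ hp
      have hγ : 0 < 1 - γ := by linarith
      have e2 : γ * B * (1 - γ) ≤ ((D : ℝ) - j) * γ := by nlinarith
      have e1 : 1 - η ≤ (1 - η / 2) * (1 - ε) := by nlinarith
      have : 0 ≤ 1 - ε := by linarith
      calc ((j : ℝ) + 1) * (1 - γ) ≤ (1 - η) * (γ * B) * (1 - γ) := by gcongr
        _ ≤ ((1 - η / 2) * (1 - ε)) * (γ * B) * (1 - γ) := by gcongr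
        _ = ((1 - η / 2) * (1 - ε)) * (γ * B * (1 - γ)) := by ring
        _ ≤ ((1 - η / 2) * (1 - ε)) * (((D : ℝ) - j) * γ) := by gcongr
        _ = _ := by ring
    _ = _ := by ring

/-- The summand 1 in the hypothesis pays for the floor. -/
theorem pow_floor_le_exp {a L : ℝ} (hη0 : 0 < η) (hη : η ≤ 1 / 2)
    (hL : 3 * L + 1 ≤ η ^ 2 * a / 2) : (1 - η / 2) ^ ⌊η * a⌋₊ ≤ Real.exp (-3 * L) := by
  have h1 : (1 - η / 2) ≤ Real.exp (-(η / 2)) := by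
    have := Real.add_one_le_exp (-(η / 2)); linarith
  calc _ ≤ Real.exp (-(η / 2)) ^ ⌊η * a⌋₊ := by gcongr; linarith
    _ = Real.exp (⌊η * a⌋₊ * (-(η / 2))) := by rw [Real.exp_nat_mul]
    _ ≤ _ := by
      apply Real.exp_le_exp.2
      have := Nat.lt_floor_add_one (η * a)
      nlinarith

/-- The last ⌊ηγB⌋ steps before `k` all lie beyond (1+η)γB, where each step gains a factor 1-η/2.
With L = log M the bound becomes M⁻³, small enough for a union bound over all vertices and values.
-/
theorem upper_tail (h : NearBinom D γ ε p) (h0 : 0 < γ) (h1 : γ < 1) (hη0 : 0 < η)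
    (hη : η ≤ 1 / 2) (hε : ε ≤ η / 8) (hDB : (D : ℝ) ≤ B) {L : ℝ}
    (hL : 3 * L + 1 ≤ η ^ 2 * (γ * B) / 2) {k : ℕ} (hk : (1 + 2 * η) * (γ * B) ≤ k) :
    p k ≤ Real.exp (-3 * L) * ∑ j ∈ range (D + 1), p j := by
  have hB : 0 ≤ γ * B := mul_nonneg h0.le ((Nat.cast_nonneg D).trans hDB)
  have hm : (⌊η * (γ * B)⌋₊ : ℝ) ≤ η * (γ * B) := Nat.floor_le (by positivity)
  have hexp := pow_floor_le_exp hη0 hη hL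
  set m := ⌊η * (γ * B)⌋₊
  have hmk : m ≤ k := by
    have : (m : ℝ) ≤ k := by nlinarith
    exact_mod_cast this
  obtain ⟨k₀, rfl⟩ := Nat.exists_eq_add_of_le' hmk
  push_cast at hk
  have hk0 : (1 + η) * (γ * B) ≤ k₀ := by linarith
  have key : ∀ i : ℕ, p (k₀ + i) ≤ (1 - η / 2) ^ i * p k₀ := by
    intro i
    induction i with
    | zero => simp
    | succ i ih =>
      have := h.succ_le_mul h0 h1 hη0 hη hε hDB (j := k₀ + i) (by
        push_cast
        have : (0 : ℝ) ≤ i := Nat.cast_nonneg i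
        linarith)
      rw [← add_assoc]
      calc _ ≤ _ := this
        _ ≤ (1 - η / 2) * ((1 - η / 2) ^ i * p k₀) := by gcongr; linarith
        _ = _ := by ring
  calc _ ≤ _ := key m
    _ ≤ _ := by
      gcongr
      · exact h.nonneg _
      · exact h.single_le_sum _

theorem lower_tail (h : NearBinom D γ ε p) (h0 : 0 < γ) (h1 : γ < 1) (hη0 : 0 < η)
    (hη : η ≤ 1 / 2) (hε : ε ≤ η / 8) (hB : 0 ≤ B) (hDB : B ≤ D) {L : ℝ}
    (hL : 3 * L + 1 ≤ η ^ 2 * (γ * B) / 2) {k : ℕ} (hk : (k : ℝ) ≤ (1 - 2 * η) * (γ * B)) :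
    p k ≤ Real.exp (-3 * L) * ∑ j ∈ range (D + 1), p j := by
  have hB : 0 ≤ γ * B := mul_nonneg h0.le hB
  have hm : (⌊η * (γ * B)⌋₊ : ℝ) ≤ η * (γ * B) := Nat.floor_le (by positivity)
  have hexp := pow_floor_le_exp hη0 hη hL
  set m := ⌊η * (γ * B)⌋₊
  have key : ∀ i ≤ m, p k ≤ (1 - η / 2) ^ i * p (k + i) := by
    intro i
    induction i with
    | zero => simp
    | succ i ih =>
      intro hi
      have hi' : ((i + 1 : ℕ) : ℝ) ≤ m := by exact_mod_cast hi
      push_cast at hi'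
      have := h.le_mul_succ h0 h1 hη0 hη hε hDB (j := k + i) (by push_cast; linarith)
      rw [← add_assoc]
      calc _ ≤ _ := ih (by omega)
        _ ≤ (1 - η / 2) ^ i * ((1 - η / 2) * p (k + i + 1)) := by
          gcongr
          exact pow_nonneg (by linarith) _
        _ = _ := by ring
  calc _ ≤ _ := key m le_rfl
    _ ≤ _ := by
      gcongr
      · exact h.nonneg _
      · exact h.single_le_sum _

end Tails
end NearBinom
-- The degree of one vertex into `S` in a random graph.
section Graphs

variable {n : ℕ}

open Classical in
/-- The graphs with degree sequence `d`. -/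
noncomputable def graphs (d : Fin n → ℕ) : Finset (SimpleGraph (Fin n)) :=
  univ.filter fun G => HasDegrees d G

theorem ncard_neighborSet (G : SimpleGraph (Fin n)) (v : Fin n) :
    (G.neighborSet v).ncard = (nb G v).card := by
  rw [← Set.ncard_coe_finset]
  congr 1
  ext w
  simp

variable {d : Fin n → ℕ} {G : SimpleGraph (Fin n)} {v u w x : Fin n}

theorem mem_graphs : G ∈ graphs d ↔ ∀ v, (nb G v).card = d v := by
  simp [graphs, HasDegrees, ncard_neighborSet]

theorem flip_mem_graphs (hG : G ∈ graphs d) (h : Switchable G v u w x) :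
    flip G v u w x ∈ graphs d := by
  rw [mem_graphs] at hG ⊢
  intro y
  rw [h.card_nb_flip, hG]

theorem le_maxDeg (d : Fin n → ℕ) (v : Fin n) : d v ≤ maxDeg d := le_sup (mem_univ v)

/-- The family `F` is invariant under switchings at `v` that do not involve `T`. -/
def SwitchClosed (v : Fin n) (T : Finset (Fin n)) (F : Finset (SimpleGraph (Fin n))) : Prop :=
  ∀ G ∈ F, ∀ u w x, u ∉ T → w ∉ T → x ∉ T → Switchable G v u w x → flip G v u w x ∈ F

open Classical in
/-- The number of graphs in `F` in which `v` has `k` neighbours in `U`. -/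
noncomputable def fiberCount (F : Finset (SimpleGraph (Fin n))) (v : Fin n) (U : Finset (Fin n))
    (k : ℕ) : ℝ := ((F.filter fun G => (nb G v ∩ U).card = k).card : ℝ)

theorem card_nb_split {S T : Finset (Fin n)} (hTS : T ⊆ S) (hG : G ∈ graphs d) :
    (nb G v ∩ T).card + (nb G v ∩ (S \ T)).card + (nb G v ∩ Sᶜ).card = d v := by
  rw [← mem_graphs.1 hG v, ← card_union_of_disjoint, ← card_union_of_disjoint,
    ← inter_union_distrib_left, ← inter_union_distrib_left, union_sdiff_of_subset hTS,
    union_compl, inter_univ]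
  · rw [← inter_union_distrib_left, union_sdiff_of_subset hTS]
    exact disjoint_compl_right.mono inter_subset_right inter_subset_right
  · exact disjoint_sdiff.mono inter_subset_right inter_subset_right

theorem totalDeg_compl (d : Fin n → ℕ) (S : Finset (Fin n)) :
    totalDeg d S + totalDeg d Sᶜ = totalM d := sum_add_sum_compl S d

theorem sum_fiberCount {F : Finset (SimpleGraph (Fin n))} {U : Finset (Fin n)} {D : ℕ}
    (h : ∀ G ∈ F, (nb G v ∩ U).card ≤ D) :
    ∑ k ∈ range (D + 1), fiberCount F v U k = F.card := by
  classical
  unfold fiberCount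
  rw [← Nat.cast_sum, ← card_eq_sum_card_fiberwise (f := fun G => (nb G v ∩ U).card)]
  intro G hG
  have := h G hG
  simp only [coe_range, Set.mem_Iio]
  omega

theorem card_nb_inter_le {S T : Finset (Fin n)} {F : Finset (SimpleGraph (Fin n))} {e : ℕ}
    (hF : F ⊆ graphs d) (hTS : T ⊆ S) (he : ∀ G ∈ F, (nb G v ∩ T).card = e) :
    ∀ G ∈ F, (nb G v ∩ (S \ T)).card ≤ d v - e := by
  intro G hG
  have := card_nb_split (v := v) hTS (hF hG)
  have := he G hG
  omega

/-- Switching `u` in `S \ T` against `w` outside `S` lowers the count by one, and the reverse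
switching raises it. A graph with count k+1 has about (k+1)(1-γ)M of the former, one with count k
about (D-k)γM of the latter. The upper estimates are exact products, and only the lower ones lose a
term of order Δ². Excluding `T` from all three free corners allows conditioning on the neighbourhood
of a vertex in `T`. -/
theorem nearBinom_fiberCount {S T : Finset (Fin n)} {F : Finset (SimpleGraph (Fin n))} {e : ℕ}
    {ε : ℝ} (hF : F ⊆ graphs d) (hTS : T ⊆ S) (hT : T.card ≤ 1)
    (he : ∀ G ∈ F, (nb G v ∩ T).card = e) (hcl : SwitchClosed v T F) (hd : 1 ≤ maxDeg d)
    (hM : 0 < (totalM d : ℝ))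
    (h1 : 6 * (maxDeg d : ℝ) ^ 2 ≤ ε * (gam d S * totalM d))
    (h2 : 6 * (maxDeg d : ℝ) ^ 2 ≤ ε * ((1 - gam d S) * totalM d)) :
    NearBinom (d v - e) (gam d S) ε (fiberCount F v (S \ T)) := by
  classical
  have hle := card_nb_inter_le hF hTS he
  have hsplit : ∀ G ∈ F, ((nb G v ∩ Sᶜ).card : ℝ) = ((d v - e : ℕ) : ℝ) -
      (nb G v ∩ (S \ T)).card := by
    intro G hG
    have h := card_nb_split (v := v) hTS (hF hG)
    have := he G hG
    rw [eq_sub_iff_add_eq]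
    have : (nb G v ∩ Sᶜ).card + (nb G v ∩ (S \ T)).card = d v - e := by omega
    exact_mod_cast this
  have hdeg : ∀ G ∈ F, ∀ A : Finset (Fin n), ∑ w ∈ A, (nb G w).card = totalDeg d A :=
    fun G hG A => sum_congr rfl fun y _ => mem_graphs.1 (hF hG) y
  have hS : (totalDeg d S : ℝ) = gam d S * totalM d := by
    unfold gam; field_simp
  have hSc : (totalDeg d Sᶜ : ℝ) = (1 - gam d S) * totalM d := by
    have : (totalDeg d S : ℝ) + totalDeg d Sᶜ = totalM d := by exact_mod_cast totalDeg_compl d S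
    linarith
  have hΔ1 : (1 : ℝ) ≤ maxDeg d := by exact_mod_cast hd
  have hU1 : (totalDeg d (S \ T) : ℝ) ≤ gam d S * totalM d := by
    rw [← hS]
    exact_mod_cast sum_le_sum_of_subset sdiff_subset
  have hU2 : gam d S * totalM d ≤ totalDeg d (S \ T) + maxDeg d := by
    rw [← hS]
    have e1 : totalDeg d (S \ T) + totalDeg d T = totalDeg d S := sum_sdiff hTS
    have e2 : totalDeg d T ≤ maxDeg d := by
      calc _ ≤ T.card • maxDeg d := sum_le_card_nsmul _ _ _ fun y _ => le_maxDeg d y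
        _ ≤ 1 * maxDeg d := Nat.mul_le_mul_right _ hT
        _ = _ := one_mul _
    exact_mod_cast (by omega : totalDeg d S ≤ totalDeg d (S \ T) + maxDeg d)
  set Δ := maxDeg d
  -- At most one excluded vertex and Δ ≥ 1 give (2Δ+3)Δ ≤ 5Δ².
  have hbad : (((2 * (Δ + 1) + (Tᶜᶜ).card) * Δ : ℕ) : ℝ) ≤ 5 * (Δ : ℝ) ^ 2 := by
    rw [compl_compl]
    have : (2 * (Δ + 1) + T.card) * Δ ≤ 5 * Δ ^ 2 := by nlinarith
    exact_mod_cast this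
  have lower : ∀ G ∈ F, ∀ U W : Finset (Fin n), ((nb G v ∩ U).card : ℝ) *
      (totalDeg d W - 5 * (Δ : ℝ) ^ 2) ≤ (switches G v U W Tᶜ).card := by
    intro G hG U W
    have h := le_card_switches G v U W Tᶜ Δ
      (fun y => by rw [mem_graphs.1 (hF hG) y]; exact le_maxDeg d y)
    rw [hdeg G hG] at h
    have h' : ((nb G v ∩ U).card : ℝ) * totalDeg d W ≤ (switches G v U W Tᶜ).card +
      (nb G v ∩ U).card * (((2 * (Δ + 1) + (Tᶜᶜ).card) * Δ : ℕ) : ℝ) := by exact_mod_cast h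
    have : ((nb G v ∩ U).card : ℝ) * (((2 * (Δ + 1) + (Tᶜᶜ).card) * Δ : ℕ) : ℝ) ≤
      (nb G v ∩ U).card * (5 * (Δ : ℝ) ^ 2) := by gcongr
    linarith
  have upper : ∀ G ∈ F, ∀ U W : Finset (Fin n), ((switches G v U W Tᶜ).card : ℝ) ≤
      (nb G v ∩ U).card * totalDeg d W := by
    intro G hG U W
    have h := card_switches_le G v U W Tᶜ
    rw [hdeg G hG] at h
    exact_mod_cast h
  have nn : ∀ k, 0 ≤ fiberCount F v (S \ T) k := fun k => Nat.cast_nonneg _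
  have fw : ∀ k : ℕ, ∀ G ∈ F.filter (fun G => (nb G v ∩ (S \ T)).card = k + 1),
      ∀ u ∈ S \ T, ∀ w ∈ Sᶜ, ∀ x ∈ Tᶜ, Switchable G v u w x →
      flip G v u w x ∈ F.filter (fun G => (nb G v ∩ (S \ T)).card = k) := by
    intro k G hG u hu w hw x hx hs
    simp only [mem_filter, mem_sdiff, mem_compl] at hG hu hw hx ⊢
    refine ⟨hcl G hG.1 u w x hu.2 (fun h => hw (hTS h)) hx hs, ?_⟩
    have e1 : nb (flip G v u w x) v ∩ (S \ T) = (nb G v ∩ (S \ T)).erase u := by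
      rw [hs.nb_flip]
      ext y
      simp only [mem_inter, mem_insert, mem_erase, mem_sdiff]
      constructor
      · rintro ⟨rfl | h, h'⟩
        · exact absurd h'.1 hw
        · exact ⟨h.1, h.2, h'⟩
      · rintro ⟨h, h', h''⟩
        exact ⟨Or.inr ⟨h, h'⟩, h''⟩
    rw [e1, card_erase_of_mem, hG.2]
    · rfl
    · simp only [mem_inter, mem_nb, mem_sdiff]
      exact ⟨hs.1, hu⟩
  have bw : ∀ k : ℕ, ∀ G ∈ F.filter (fun G => (nb G v ∩ (S \ T)).card = k),
      ∀ u ∈ Sᶜ, ∀ w ∈ S \ T, ∀ x ∈ Tᶜ, Switchable G v u w x →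
      flip G v u w x ∈ F.filter (fun G => (nb G v ∩ (S \ T)).card = k + 1) := by
    intro k G hG u hu w hw x hx hs
    simp only [mem_filter, mem_sdiff, mem_compl] at hG hu hw hx ⊢
    refine ⟨hcl G hG.1 u w x (fun h => hu (hTS h)) hw.2 hx hs, ?_⟩
    have e1 : nb (flip G v u w x) v ∩ (S \ T) = insert w (nb G v ∩ (S \ T)) := by
      rw [hs.nb_flip]
      ext y
      simp only [mem_inter, mem_insert, mem_erase, mem_sdiff]
      constructor
      · rintro ⟨rfl | h, h'⟩
        · exact Or.inl rfl
        · exact Or.inr ⟨h.2, h'⟩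
      · rintro (rfl | h)
        · exact ⟨Or.inl rfl, hw⟩
        · exact ⟨Or.inr ⟨fun e => hu (e ▸ h.2.1), h.1⟩, h.2⟩
    rw [e1, card_insert_of_notMem, hG.2]
    simp only [mem_inter, mem_nb, not_and]
    exact fun h => absurd h hs.2.2.1
  refine ⟨nn, ?_, ?_, ?_⟩
  · intro k hk
    simp only [fiberCount, Nat.cast_eq_zero, card_eq_zero, filter_eq_empty_iff]
    intro G hG
    have := hle G hG
    omega
  · intro k hk
    have hsum := sum_switches_le _ _ v (S \ T) Sᶜ Tᶜ (fw k)
    have hL : fiberCount F v (S \ T) (k + 1) *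
        (((k : ℝ) + 1) * (totalDeg d Sᶜ - 5 * (Δ : ℝ) ^ 2)) ≤
        ((∑ G ∈ F.filter (fun G => (nb G v ∩ (S \ T)).card = k + 1),
          (switches G v (S \ T) Sᶜ Tᶜ).card : ℕ) : ℝ) := by
      rw [Nat.cast_sum, fiberCount, ← nsmul_eq_mul]
      refine card_nsmul_le_sum _ _ _ fun G hG => ?_
      obtain ⟨hG, hk⟩ := mem_filter.1 hG
      have := lower G hG (S \ T) Sᶜ
      rw [hk] at this
      exact_mod_cast this
    have hR : ((∑ G ∈ F.filter (fun G => (nb G v ∩ (S \ T)).card = k),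
          (switches G v Sᶜ (S \ T) Tᶜ).card : ℕ) : ℝ) ≤ fiberCount F v (S \ T) k *
        ((((d v - e : ℕ) : ℝ) - k) * (gam d S * totalM d)) := by
      rw [Nat.cast_sum, fiberCount, ← nsmul_eq_mul]
      refine sum_le_card_nsmul _ _ _ fun G hG => ?_
      obtain ⟨hG, hk⟩ := mem_filter.1 hG
      refine (upper G hG Sᶜ (S \ T)).trans ?_
      rw [← hk, ← hsplit G hG]
      gcongr
    have hLR := (hL.trans (Nat.cast_le.2 hsum)).trans hR
    refine le_of_mul_le_mul_right ?_ hM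
    have hp := nn (k + 1)
    calc _ = fiberCount F v (S \ T) (k + 1) *
          (((k : ℝ) + 1) * ((1 - gam d S) * totalM d - ε * ((1 - gam d S) * totalM d))) := by ring
      _ ≤ fiberCount F v (S \ T) (k + 1) *
        (((k : ℝ) + 1) * (totalDeg d Sᶜ - 5 * (Δ : ℝ) ^ 2)) := by
          refine mul_le_mul_of_nonneg_left (mul_le_mul_of_nonneg_left ?_ (by positivity)) hp
          nlinarith
      _ ≤ _ := hLR
      _ = _ := by ring
  · intro k hk
    have hsum := sum_switches_le _ _ v Sᶜ (S \ T) Tᶜ (bw k)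
    have hkD : (0 : ℝ) ≤ ((d v - e : ℕ) : ℝ) - k := by
      have : (k : ℝ) ≤ ((d v - e : ℕ) : ℝ) := by exact_mod_cast hk.le
      linarith
    have hL : fiberCount F v (S \ T) k *
        ((((d v - e : ℕ) : ℝ) - k) * (totalDeg d (S \ T) - 5 * (Δ : ℝ) ^ 2)) ≤
        ((∑ G ∈ F.filter (fun G => (nb G v ∩ (S \ T)).card = k),
          (switches G v Sᶜ (S \ T) Tᶜ).card : ℕ) : ℝ) := by
      rw [Nat.cast_sum, fiberCount, ← nsmul_eq_mul]
      refine card_nsmul_le_sum _ _ _ fun G hG => ?_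
      obtain ⟨hG, hk⟩ := mem_filter.1 hG
      have := lower G hG Sᶜ (S \ T)
      rwa [hsplit G hG, hk] at this
    have hR : ((∑ G ∈ F.filter (fun G => (nb G v ∩ (S \ T)).card = k + 1),
          (switches G v (S \ T) Sᶜ Tᶜ).card : ℕ) : ℝ) ≤ fiberCount F v (S \ T) (k + 1) *
        (((k : ℝ) + 1) * ((1 - gam d S) * totalM d)) := by
      rw [Nat.cast_sum, fiberCount, ← nsmul_eq_mul]
      refine sum_le_card_nsmul _ _ _ fun G hG => ?_
      obtain ⟨hG, hk⟩ := mem_filter.1 hG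
      refine (upper G hG (S \ T) Sᶜ).trans ?_
      rw [hk, hSc]
      push_cast
      rfl
    have hLR := (hL.trans (Nat.cast_le.2 hsum)).trans hR
    refine le_of_mul_le_mul_right ?_ hM
    have hp := nn k
    calc _ = fiberCount F v (S \ T) k *
          ((((d v - e : ℕ) : ℝ) - k) * (gam d S * totalM d - ε * (gam d S * totalM d))) := by ring
      _ ≤ fiberCount F v (S \ T) k *
        ((((d v - e : ℕ) : ℝ) - k) * (totalDeg d (S \ T) - 5 * (Δ : ℝ) ^ 2)) := by
          -- Removing `T` from `S` costs at most Δ ≤ Δ² in total degree; with the 5Δ² bad choices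
          -- this exhausts the 6Δ² of the hypothesis.
          refine mul_le_mul_of_nonneg_left (mul_le_mul_of_nonneg_left ?_ hkD) hp
          nlinarith
      _ ≤ _ := hLR
      _ = _ := by ring

end Graphs
-- Approximate independence of two vertices.
section Pairs

variable {n : ℕ} {d : Fin n → ℕ}

theorem switchClosed_graphs (v : Fin n) : SwitchClosed v ∅ (graphs d) :=
  fun _ hG _ _ _ _ _ _ hs => flip_mem_graphs hG hs

/-- A switching none of whose corners is `w` preserves the neighbourhood of `w`, hence every event
that depends on it alone. -/
theorem switchClosed_of_nb {v w : Fin n} (hvw : v ≠ w) (P : Finset (Fin n) → Prop)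
    {F : Finset (SimpleGraph (Fin n))} (hF : ∀ G, G ∈ F ↔ G ∈ graphs d ∧ P (nb G w)) :
    SwitchClosed v {w} F := by
  intro G hG u w' x hu hw' hx hs
  rw [hF] at hG ⊢
  refine ⟨flip_mem_graphs hG.1 hs, ?_⟩
  rw [nb_flip_of_ne hvw.symm (fun e => hu (by simp [e])) (fun e => hw' (by simp [e]))
    (fun e => hx (by simp [e]))]
  exact hG.2

/-- The hypotheses under which switchings reproduce the binomial distribution with parameter
`gam d S` up to factors `1 - ε`. -/
structure GoodError (d : Fin n → ℕ) (S : Finset (Fin n)) (ε : ℝ) : Prop where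
  one_le_maxDeg : 1 ≤ maxDeg d
  totalM_pos : 0 < (totalM d : ℝ)
  gam_pos : 0 < gam d S
  gam_lt_one : gam d S < 1
  nonneg : 0 ≤ ε
  le_one : ε ≤ 1
  le_in : 6 * (maxDeg d : ℝ) ^ 2 ≤ ε * (gam d S * totalM d)
  le_out : 6 * (maxDeg d : ℝ) ^ 2 ≤ ε * ((1 - gam d S) * totalM d)

variable {S : Finset (Fin n)} {ε : ℝ}

namespace GoodError

theorem nearBinom (h : GoodError d S ε) (v : Fin n) :
    NearBinom (d v) (gam d S) ε (fiberCount (graphs d) v S) := by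
  have := nearBinom_fiberCount (v := v) (e := 0) subset_rfl (empty_subset S) (by simp)
    (by simp) (switchClosed_graphs v) h.one_le_maxDeg h.totalM_pos h.le_in h.le_out
  simpa using this

theorem sum_fiberCount_graphs (v : Fin n) :
    ∑ k ∈ range (d v + 1), fiberCount (graphs d) v S k = (graphs d).card :=
  sum_fiberCount fun G hG => by
    rw [← mem_graphs.1 hG v]
    exact card_le_card inter_subset_left

theorem fiberCount_le_of_closed (h : GoodError d S ε) {v : Fin n} {T : Finset (Fin n)}
    {F : Finset (SimpleGraph (Fin n))} {e : ℕ} (hF : F ⊆ graphs d) (hTS : T ⊆ S)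
    (hT : T.card ≤ 1) (he : ∀ G ∈ F, (nb G v ∩ T).card = e) (hcl : SwitchClosed v T F) (k : ℕ) :
    (1 - ε) ^ d v * fiberCount F v (S \ T) k ≤ binomPmf (d v - e) (gam d S) k * F.card := by
  have hn := nearBinom_fiberCount hF hTS hT he hcl h.one_le_maxDeg h.totalM_pos h.le_in h.le_out
  have h0 := h.nonneg
  have h1 := h.le_one
  calc _ ≤ (1 - ε) ^ (d v - e) * fiberCount F v (S \ T) k := by
        refine mul_le_mul_of_nonneg_right ?_ (hn.nonneg k)
        exact pow_le_pow_of_le_one (by linarith) (by linarith) (by omega)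
    _ ≤ _ := by
        rw [← sum_fiberCount (card_nb_inter_le hF hTS he)]
        exact hn.le_binomPmf h.gam_pos h.gam_lt_one h0 h1 k

-- The single-vertex bound is used twice. Among graphs with the adjacency of `v`, `w` and the count
-- at `w` prescribed, switch at `v`; then, with only the adjacency prescribed, switch at `w`. Each
-- use costs one factor `q`.
open Classical in
theorem card_joint_le (h : GoodError d S ε) {v w : Fin n} (hvw : v ≠ w) (hv : v ∈ S)
    (hw : w ∈ S) (Q : Prop) (j : ℕ) {q : ℝ} (hq0 : 0 ≤ q) (hqv : q ≤ (1 - ε) ^ d v)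
    (hqw : q ≤ (1 - ε) ^ d w) :
    q ^ 2 * ((graphs d).filter fun G => (G.Adj v w ↔ Q) ∧ (nb G v ∩ (S \ {w})).card = j ∧
      (nb G w ∩ (S \ {v})).card = j).card ≤
    binomPmf (d v - if Q then 1 else 0) (gam d S) j *
      binomPmf (d w - if Q then 1 else 0) (gam d S) j *
      ((graphs d).filter fun G => (G.Adj v w ↔ Q)).card := by
  have hnb : ∀ G : SimpleGraph (Fin n), ∀ a b : Fin n,
      (nb G a ∩ {b}).card = if G.Adj a b then 1 else 0 := by
    intro G a b
    by_cases hab : G.Adj a b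
    · rw [if_pos hab, inter_singleton_of_mem (by simpa), card_singleton]
    · rw [if_neg hab, inter_singleton_of_notMem (by simpa), card_empty]
  have hb := binomPmf_nonneg (d v - if Q then 1 else 0) h.gam_pos.le h.gam_lt_one.le j
  have s1 := h.fiberCount_le_of_closed (v := v) (T := {w}) (e := if Q then 1 else 0)
    (F := (graphs d).filter fun G => (v ∈ nb G w ↔ Q) ∧ (nb G w ∩ (S \ {v})).card = j)
    (filter_subset _ _) (by simpa) (by simp)
    (fun G hG => by
      have := (mem_filter.1 hG).2.1
      rw [mem_nb, G.adj_comm] at this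
      rw [hnb]; simp [this])
    (switchClosed_of_nb hvw (fun N => (v ∈ N ↔ Q) ∧ (N ∩ (S \ {v})).card = j)
      fun G => mem_filter) j
  have s2 := h.fiberCount_le_of_closed (v := w) (T := {v}) (e := if Q then 1 else 0)
    (F := (graphs d).filter fun G => (w ∈ nb G v ↔ Q))
    (filter_subset _ _) (by simpa) (by simp)
    (fun G hG => by
      have := (mem_filter.1 hG).2
      rw [mem_nb, G.adj_comm] at this
      rw [hnb]; simp [this])
    (switchClosed_of_nb hvw.symm (fun N => (w ∈ N ↔ Q)) fun G => mem_filter) j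
  have e1 : ((graphs d).filter fun G => (v ∈ nb G w ↔ Q) ∧ (nb G w ∩ (S \ {v})).card = j).filter
      (fun G => (nb G v ∩ (S \ {w})).card = j) = (graphs d).filter fun G => (G.Adj v w ↔ Q) ∧
      (nb G v ∩ (S \ {w})).card = j ∧ (nb G w ∩ (S \ {v})).card = j := by
    ext G
    simp only [mem_filter, mem_nb, G.adj_comm w v]
    tauto
  have e2 : ((graphs d).filter fun G => (w ∈ nb G v ↔ Q)).filter
      (fun G => (nb G w ∩ (S \ {v})).card = j) =
      (graphs d).filter fun G => (v ∈ nb G w ↔ Q) ∧ (nb G w ∩ (S \ {v})).card = j := by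
    ext G
    simp only [mem_filter, mem_nb, G.adj_comm w v]
    tauto
  rw [fiberCount, e1] at s1
  rw [fiberCount, e2] at s2
  simp only [mem_nb] at s1 s2
  generalize ((graphs d).filter fun G => (G.Adj v w ↔ Q) ∧
    (nb G v ∩ (S \ {w})).card = j ∧ (nb G w ∩ (S \ {v})).card = j).card = A at s1 ⊢
  generalize ((graphs d).filter fun G => (G.Adj w v ↔ Q) ∧
    (nb G w ∩ (S \ {v})).card = j).card = B at s1 s2
  generalize ((graphs d).filter fun G => (G.Adj v w ↔ Q)).card = C at s2 ⊢
  generalize binomPmf (d v - if Q then 1 else 0) (gam d S) j = b at hb s1 ⊢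
  generalize binomPmf (d w - if Q then 1 else 0) (gam d S) j = b' at s2 ⊢
  calc q ^ 2 * (A : ℝ) = q * (q * A) := by ring
    _ ≤ q * ((1 - ε) ^ d v * A) := by gcongr
    _ ≤ q * (b * B) := by gcongr
    _ = b * (q * B) := by ring
    _ ≤ b * ((1 - ε) ^ d w * B) := by gcongr
    _ ≤ b * (b' * C) := by gcongr
    _ = _ := by ring

end GoodError

-- Switch the edge `vw` away: about M choices of a second edge are available, while the reverse
-- switching is determined by a neighbour of `v` and a neighbour of `w`. So adjacency has
-- probability at most d(v)d(w)/(M-4Δ²).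
open Classical in
theorem card_adj_le (hd : 1 ≤ maxDeg d) (v w : Fin n) :
    (((graphs d).filter fun G => G.Adj v w).card : ℝ) *
      (totalM d - 4 * (maxDeg d : ℝ) ^ 2) ≤ d v * d w * (graphs d).card := by
  have hsum := sum_switches_le ((graphs d).filter fun G => G.Adj v w) (graphs d) v {w} univ univ
    (fun G hG u _ w _ x _ hs => flip_mem_graphs (mem_filter.1 hG).1 hs)
  have hR : ((∑ G ∈ graphs d, (switches G v univ {w} univ).card : ℕ) : ℝ) ≤
      (graphs d).card * (d v * d w : ℝ) := by
    rw [Nat.cast_sum, ← nsmul_eq_mul]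
    refine sum_le_card_nsmul _ _ _ fun G hG => ?_
    have := card_switches_le G v univ {w} univ
    rw [inter_univ, sum_singleton, mem_graphs.1 hG, mem_graphs.1 hG] at this
    exact_mod_cast this
  have hL : (((graphs d).filter fun G => G.Adj v w).card : ℝ) *
      (totalM d - 4 * (maxDeg d : ℝ) ^ 2) ≤
      ((∑ G ∈ (graphs d).filter fun G => G.Adj v w, (switches G v {w} univ univ).card : ℕ) : ℝ) := by
    rw [Nat.cast_sum, ← nsmul_eq_mul]
    refine card_nsmul_le_sum _ _ _ fun G hG => ?_
    obtain ⟨hG, ha⟩ := mem_filter.1 hG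
    have h := le_card_switches G v {w} univ univ (maxDeg d)
      (fun y => by rw [mem_graphs.1 hG y]; exact le_maxDeg d y)
    rw [inter_singleton_of_mem (by simpa), card_singleton, one_mul, one_mul, compl_univ,
      card_empty, add_zero, sum_congr rfl fun y _ => mem_graphs.1 hG y] at h
    have h2 : totalM d ≤ (switches G v {w} univ univ).card + 4 * maxDeg d ^ 2 := by
      have h' : totalM d ≤ _ := h
      have : 2 * (maxDeg d + 1) * maxDeg d ≤ 4 * maxDeg d ^ 2 := by nlinarith
      omega
    have h3 : (totalM d : ℝ) ≤ (switches G v {w} univ univ).card + 4 * (maxDeg d : ℝ) ^ 2 := by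
      exact_mod_cast h2
    linarith
  refine (hL.trans (Nat.cast_le.2 hsum)).trans (hR.trans (le_of_eq ?_))
  ring

namespace GoodError

-- Non-adjacent pairs give the main term. For adjacent pairs both indices drop by one, and size
-- biasing contributes i²/(d(v)d(w)γ²); the degrees cancel against the adjacency probability,
-- leaving (i/γ)²/(M-4Δ²) ≤ κ.
open Classical in
theorem card_pair_le (h : GoodError d S ε) {v w : Fin n} (hvw : v ≠ w) (hv : v ∈ S)
    (hw : w ∈ S) (hdv : 1 ≤ d v) (hdw : 1 ≤ d w) (i : ℕ) {q κ : ℝ} (hq0 : 0 ≤ q)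
    (hqv : q ≤ (1 - ε) ^ d v) (hqw : q ≤ (1 - ε) ^ d w)
    (hκ : ((i : ℝ) / gam d S) ^ 2 ≤ κ * (totalM d - 4 * (maxDeg d : ℝ) ^ 2))
    (hM : 0 < totalM d - 4 * (maxDeg d : ℝ) ^ 2) :
    q ^ 2 * ((graphs d).filter fun G => (nb G v ∩ S).card = i ∧ (nb G w ∩ S).card = i).card ≤
    (1 + κ) * (binomPmf (d v) (gam d S) i * binomPmf (d w) (gam d S) i * (graphs d).card) := by
  have hb1 := binomPmf_nonneg (d v) h.gam_pos.le h.gam_lt_one.le i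
  have hb2 := binomPmf_nonneg (d w) h.gam_pos.le h.gam_lt_one.le i
  have hsd : ∀ (G : SimpleGraph (Fin n)) (a b : Fin n), b ∈ S → (nb G a ∩ S).card =
      (nb G a ∩ (S \ {b})).card + if G.Adj a b then 1 else 0 := by
    intro G a b hb
    by_cases hab : G.Adj a b
    · rw [if_pos hab, ← inter_sdiff_assoc, sdiff_singleton_eq_erase, card_erase_add_one]
      simpa using ⟨hab, hb⟩
    · rw [if_neg hab, ← inter_sdiff_assoc, sdiff_singleton_eq_erase, erase_eq_of_notMem,
        add_zero]
      simp [hab]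
  have hsplit := card_filter_add_card_filter_not (s := (graphs d).filter fun G =>
    (nb G v ∩ S).card = i ∧ (nb G w ∩ S).card = i) (fun G => G.Adj v w)
  have hno : q ^ 2 * ((((graphs d).filter fun G => (nb G v ∩ S).card = i ∧
      (nb G w ∩ S).card = i).filter fun G => ¬ G.Adj v w).card : ℝ) ≤
      binomPmf (d v) (gam d S) i * binomPmf (d w) (gam d S) i * (graphs d).card := by
    have := h.card_joint_le hvw hv hw False i hq0 hqv hqw
    simp only [if_false, Nat.sub_zero, iff_false] at this
    have e : ((graphs d).filter fun G => (nb G v ∩ S).card = i ∧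
        (nb G w ∩ S).card = i).filter (fun G => ¬ G.Adj v w) = (graphs d).filter fun G =>
        ¬ G.Adj v w ∧ (nb G v ∩ (S \ {w})).card = i ∧ (nb G w ∩ (S \ {v})).card = i := by
      ext G
      simp only [mem_filter, hsd G v w hw, hsd G w v hv, G.adj_comm w v]
      by_cases ha : G.Adj v w <;> simp [ha]
    rw [e]
    refine this.trans ?_
    gcongr
    exact filter_subset _ _
  have hyes : q ^ 2 * ((((graphs d).filter fun G => (nb G v ∩ S).card = i ∧
      (nb G w ∩ S).card = i).filter fun G => G.Adj v w).card : ℝ) ≤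
      κ * (binomPmf (d v) (gam d S) i * binomPmf (d w) (gam d S) i * (graphs d).card) := by
    have hκ0 : 0 ≤ κ := by
      by_contra hc
      have : κ * (totalM d - 4 * (maxDeg d : ℝ) ^ 2) < 0 :=
        mul_neg_of_neg_of_pos (by linarith) hM
      have := sq_nonneg ((i : ℝ) / gam d S)
      linarith
    rcases i with _ | j
    · have e : ((graphs d).filter fun G => (nb G v ∩ S).card = 0 ∧
          (nb G w ∩ S).card = 0).filter (fun G => G.Adj v w) = ∅ := by
        ext G
        simp only [mem_filter, hsd G v w hw]
        by_cases ha : G.Adj v w <;> simp [ha]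
      rw [e]
      simp only [card_empty, Nat.cast_zero, mul_zero]
      positivity
    have := h.card_joint_le hvw hv hw True j hq0 hqv hqw
    simp only [if_true, iff_true] at this
    have e : ((graphs d).filter fun G => (nb G v ∩ S).card = j + 1 ∧
        (nb G w ∩ S).card = j + 1).filter (fun G => G.Adj v w) = (graphs d).filter fun G =>
        G.Adj v w ∧ (nb G v ∩ (S \ {w})).card = j ∧ (nb G w ∩ (S \ {v})).card = j := by
      ext G
      simp only [mem_filter, hsd G v w hw, hsd G w v hv, G.adj_comm w v]
      by_cases ha : G.Adj v w <;> simp [ha]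
    rw [e]
    refine this.trans ?_
    obtain ⟨a, ha⟩ := Nat.exists_eq_add_of_le' hdv
    obtain ⟨b, hb⟩ := Nat.exists_eq_add_of_le' hdw
    have hadj := card_adj_le h.one_le_maxDeg v w
    have hγ := h.gam_pos
    rw [ha, hb, Nat.add_sub_cancel, Nat.add_sub_cancel, binomPmf_succ_succ hγ,
      binomPmf_succ_succ hγ (D := b)]
    rw [ha, hb] at hadj
    rw [ha] at hb1
    rw [hb] at hb2
    set A := (((graphs d).filter fun G => G.Adj v w).card : ℝ)
    have hA : A ≤ ((a + 1 : ℕ) : ℝ) * ((b + 1 : ℕ) : ℝ) * (graphs d).card /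
        (totalM d - 4 * (maxDeg d : ℝ) ^ 2) := by
      rwa [le_div_iff₀ hM]
    have hκ' : (((j + 1 : ℕ) : ℝ) / gam d S) ^ 2 / (totalM d - 4 * (maxDeg d : ℝ) ^ 2) ≤ κ := by
      rwa [div_le_iff₀ hM]
    push_cast at hA hκ'
    set b1 := binomPmf (a + 1) (gam d S) (j + 1)
    set b2 := binomPmf (b + 1) (gam d S) (j + 1)
    set M' := totalM d - 4 * (maxDeg d : ℝ) ^ 2
    calc _ ≤ ((j : ℝ) + 1) / (((a : ℝ) + 1) * gam d S) * b1 *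
          (((j : ℝ) + 1) / (((b : ℝ) + 1) * gam d S) * b2) *
          (((a : ℝ) + 1) * ((b : ℝ) + 1) * (graphs d).card / M') := by gcongr
      _ = (((j : ℝ) + 1) / gam d S) ^ 2 / M' * (b1 * b2 * (graphs d).card) := by
        field_simp
      _ ≤ _ := by gcongr
  rw [← hsplit]
  push_cast
  linarith

end GoodError
end Pairs
-- Second moments of degree counts and Chebyshev's inequality.
section SecondMoment

variable {n : ℕ} {d : Fin n → ℕ} {S : Finset (Fin n)} {ε : ℝ}

/-- The number of vertices of `A` that have exactly `i` neighbours in `S`. -/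
noncomputable def degCount (G : SimpleGraph (Fin n)) (S A : Finset (Fin n)) (i : ℕ) : ℕ :=
  (A.filter fun v => (nb G v ∩ S).card = i).card

open Classical in
theorem sum_degCount (A : Finset (Fin n)) (i : ℕ) :
    ∑ G ∈ graphs d, (degCount G S A i : ℝ) = ∑ v ∈ A, fiberCount (graphs d) v S i := by
  have : ∀ G : SimpleGraph (Fin n), (degCount G S A i : ℝ) =
      ∑ v ∈ A, if (nb G v ∩ S).card = i then 1 else 0 := by
    intro G; simp [degCount]
  simp only [this, fiberCount]
  rw [sum_comm]
  refine sum_congr rfl fun v _ => ?_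
  simp

open Classical in
theorem sum_degCount_sq (A : Finset (Fin n)) (i : ℕ) :
    ∑ G ∈ graphs d, (degCount G S A i : ℝ) ^ 2 = ∑ v ∈ A, ∑ w ∈ A,
      (((graphs d).filter fun G => (nb G v ∩ S).card = i ∧ (nb G w ∩ S).card = i).card : ℝ) := by
  have : ∀ G : SimpleGraph (Fin n), (degCount G S A i : ℝ) ^ 2 =
      ∑ v ∈ A, ∑ w ∈ A, if (nb G v ∩ S).card = i ∧ (nb G w ∩ S).card = i then 1 else 0 := by
    intro G
    have e : (degCount G S A i : ℝ) = ∑ v ∈ A, if (nb G v ∩ S).card = i then 1 else 0 := by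
      simp [degCount]
    rw [sq, e, sum_mul_sum]
    refine sum_congr rfl fun v _ => sum_congr rfl fun w _ => ?_
    by_cases h1 : (nb G v ∩ S).card = i <;> simp [h1]
  simp only [this]
  rw [sum_comm]
  refine sum_congr rfl fun v _ => ?_
  rw [sum_comm]
  refine sum_congr rfl fun w _ => ?_
  simp

-- The deviation is taken from the binomial mean μ, not the true mean. After division by the number
-- of graphs, E X ≥ (1-κ')μ and E X² ≤ (1+κ')(μ+μ²), where the term μ comes from the diagonal.
-- Expanding the square then leaves (1+κ')μ + 3κ'μ².
open Classical in
theorem GoodError.sum_sq_sub_le (h : GoodError d S ε) {A : Finset (Fin n)} (hA : A ⊆ S)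
    (hd : ∀ v ∈ A, 1 ≤ d v) (i : ℕ) {q κ κ' : ℝ} (hq0 : 0 < q) (hq1 : q ≤ 1)
    (hq : ∀ v ∈ A, q ≤ (1 - ε) ^ d v)
    (hκ : ((i : ℝ) / gam d S) ^ 2 ≤ κ * (totalM d - 4 * (maxDeg d : ℝ) ^ 2))
    (hM : 0 < totalM d - 4 * (maxDeg d : ℝ) ^ 2) (hκ0 : 0 ≤ κ) (hκ' : 1 + κ ≤ (1 + κ') * q ^ 2)
    (hqκ : 1 - κ' ≤ q) (hκ1 : κ' ≤ 1) :
    ∑ G ∈ graphs d, ((degCount G S A i : ℝ) - ∑ v ∈ A, binomPmf (d v) (gam d S) i) ^ 2 ≤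
      (2 * (∑ v ∈ A, binomPmf (d v) (gam d S) i) +
        3 * κ' * (∑ v ∈ A, binomPmf (d v) (gam d S) i) ^ 2) * (graphs d).card := by
  set b : Fin n → ℝ := fun v => binomPmf (d v) (gam d S) i
  have hb0 : ∀ v, 0 ≤ b v := fun v => binomPmf_nonneg _ h.gam_pos.le h.gam_lt_one.le _
  set μ := ∑ v ∈ A, b v with hμ
  have hμ0 : 0 ≤ μ := sum_nonneg fun v _ => hb0 v
  set Ω : ℝ := ((graphs d).card : ℝ) with hΩ
  have hΩ0 : 0 ≤ Ω := Nat.cast_nonneg _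
  have hκ'0 : 0 ≤ κ' := by nlinarith [pow_le_one₀ hq0.le hq1 (n := 2), pow_pos hq0 2]
  have hq2 : (1 + κ') * q ^ 2 ≤ (1 + κ') * q := by
    have : q ^ 2 ≤ q := by nlinarith
    gcongr
  have fib_nonneg : ∀ v, 0 ≤ fiberCount (graphs d) v S i := fun v => Nat.cast_nonneg _
  have fib_le : ∀ v ∈ A, fiberCount (graphs d) v S i ≤ (1 + κ') * (b v * Ω) := by
    intro v hv
    have h1 := (h.nearBinom v).le_binomPmf h.gam_pos h.gam_lt_one h.nonneg h.le_one i
    rw [sum_fiberCount_graphs] at h1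
    have h2 : q * fiberCount (graphs d) v S i ≤ b v * Ω :=
      (mul_le_mul_of_nonneg_right (hq v hv) (fib_nonneg v)).trans h1
    have h3 : 0 ≤ b v * Ω := mul_nonneg (hb0 v) hΩ0
    refine le_of_mul_le_mul_left ?_ hq0
    nlinarith
  have le_fib : ∀ v ∈ A, (1 - κ') * (b v * Ω) ≤ fiberCount (graphs d) v S i := by
    intro v hv
    have h1 := (h.nearBinom v).binomPmf_le h.gam_pos h.gam_lt_one h.nonneg h.le_one i
    rw [sum_fiberCount_graphs] at h1
    have h3 : 0 ≤ b v * Ω := mul_nonneg (hb0 v) hΩ0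
    exact (mul_le_mul_of_nonneg_right (hqκ.trans (hq v hv)) h3).trans h1
  have hX : (1 - κ') * (μ * Ω) ≤ ∑ G ∈ graphs d, (degCount G S A i : ℝ) := by
    rw [sum_degCount, hμ, sum_mul, mul_sum]
    exact sum_le_sum le_fib
  have hXX : ∑ G ∈ graphs d, (degCount G S A i : ℝ) ^ 2 ≤
      (1 + κ') * (μ * Ω) + (1 + κ') * (μ ^ 2 * Ω) := by
    rw [sum_degCount_sq]
    have hvw : ∀ v ∈ A, ∀ w ∈ A,
        (((graphs d).filter fun G => (nb G v ∩ S).card = i ∧ (nb G w ∩ S).card = i).card : ℝ) ≤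
        (1 + κ') * (b v * b w * Ω) + if v = w then (1 + κ') * (b v * Ω) else 0 := by
      intro v hv w hw
      have h3 : 0 ≤ b v * b w * Ω := mul_nonneg (mul_nonneg (hb0 v) (hb0 w)) hΩ0
      by_cases hne : v = w
      · subst hne
        rw [if_pos rfl]
        simp only [and_self]
        have := fib_le v hv
        unfold fiberCount at this
        nlinarith
      · rw [if_neg hne, add_zero]
        have := h.card_pair_le hne (hA hv) (hA hw) (hd v hv) (hd w hw) i hq0.le (hq v hv)
          (hq w hw) hκ hM
        refine le_of_mul_le_mul_left (this.trans ?_) (pow_pos hq0 2)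
        have := mul_le_mul_of_nonneg_right hκ' h3
        linarith
    calc _ ≤ ∑ v ∈ A, ∑ w ∈ A,
          ((1 + κ') * (b v * b w * Ω) + if v = w then (1 + κ') * (b v * Ω) else 0) :=
          sum_le_sum fun v hv => sum_le_sum fun w hw => hvw v hv w hw
      _ = (1 + κ') * (μ * Ω) + (1 + κ') * (μ ^ 2 * Ω) := by
          have e1 : ∀ v ∈ A, ∑ w ∈ A,
              ((1 + κ') * (b v * b w * Ω) + if v = w then (1 + κ') * (b v * Ω) else 0) =
              (1 + κ') * Ω * b v * μ + (1 + κ') * Ω * b v := by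
            intro v hv
            rw [sum_add_distrib, sum_ite_eq, if_pos hv, hμ, mul_sum]
            congr 1
            · exact sum_congr rfl fun w _ => by ring
            · ring
          rw [sum_congr rfl e1, sum_add_distrib, ← sum_mul, ← mul_sum, ← hμ]
          ring
  have hexp : ∑ G ∈ graphs d, ((degCount G S A i : ℝ) - μ) ^ 2 =
      ∑ G ∈ graphs d, (degCount G S A i : ℝ) ^ 2 -
        2 * μ * ∑ G ∈ graphs d, (degCount G S A i : ℝ) + Ω * μ ^ 2 := by
    simp only [sub_sq, sum_add_distrib, sum_sub_distrib, sum_const, nsmul_eq_mul, mul_sum]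
    congr 2
    exact sum_congr rfl fun G _ => by ring
  rw [hexp]
  have h5 := mul_le_mul_of_nonneg_left hX (by positivity : 0 ≤ 2 * μ)
  have h6 : κ' * (μ * Ω) ≤ μ * Ω := mul_le_of_le_one_left (by positivity) hκ1
  nlinarith

open Classical in
/-- Chebyshev's inequality. -/
theorem card_filter_abs_mul_sq_le {α : Type*} (Ω : Finset α) (X : α → ℝ) (t : ℝ) (ht : 0 ≤ t) :
    ((Ω.filter fun G => t < |X G|).card : ℝ) * t ^ 2 ≤ ∑ G ∈ Ω, X G ^ 2 := by
  calc _ ≤ ∑ G ∈ Ω.filter fun G => t < |X G|, X G ^ 2 := by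
        rw [← nsmul_eq_mul]
        refine card_nsmul_le_sum _ _ _ fun G hG => ?_
        rw [← sq_abs (X G)]
        have := (mem_filter.1 hG).2
        gcongr
    _ ≤ _ := sum_le_sum_of_subset_of_nonneg (filter_subset _ _) fun _ _ _ => sq_nonneg _

open Classical in
theorem card_filter_degree_le {v : Fin n} {P : ℕ → Prop} {e : ℝ}
    (h : ∀ k, P k → fiberCount (graphs d) v S k ≤ e * (graphs d).card) (he : 0 ≤ e) :
    (((graphs d).filter fun G => P (nb G v ∩ S).card).card : ℝ) ≤
      ((d v : ℝ) + 1) * e * (graphs d).card := by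
  rw [card_eq_sum_card_fiberwise (f := fun G => (nb G v ∩ S).card) (t := range (d v + 1))]
  · push_cast
    calc _ ≤ ∑ k ∈ range (d v + 1), e * (graphs d).card := by
          refine sum_le_sum fun k _ => ?_
          by_cases hk : P k
          · refine le_trans ?_ (h k hk)
            unfold fiberCount
            gcongr
            exact filter_subset _ _
          · have : ((graphs d).filter fun G => P (nb G v ∩ S).card).filter
                (fun G => (nb G v ∩ S).card = k) = ∅ := by
              ext G
              simp only [mem_filter, notMem_empty, iff_false, not_and]
              rintro ⟨_, hP⟩ rfl
              exact hk hP
            rw [this]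
            simp only [card_empty, Nat.cast_zero]
            positivity
      _ = _ := by rw [sum_const, card_range, nsmul_eq_mul]; push_cast; ring
  · intro G hG
    have h1 := mem_graphs.1 (mem_filter.1 hG).1 v
    have : (nb G v ∩ S).card ≤ (nb G v).card := card_le_card inter_subset_left
    simp only [coe_range, Set.mem_Iio]
    omega

end SecondMoment
-- The model sequence: location of its entries and rounding errors.
section Model

variable {n : ℕ} {d : Fin n → ℕ} {S : Finset (Fin n)}

theorem binomCdf_nonneg (D : ℕ) {γ : ℝ} (h0 : 0 ≤ γ) (h1 : γ ≤ 1) (j : ℕ) : 0 ≤ binomCdf D γ j :=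
  sum_nonneg fun k _ => binomPmf_nonneg D h0 h1 k

theorem binomCdf_le_one (D : ℕ) {γ : ℝ} (h0 : 0 ≤ γ) (h1 : γ ≤ 1) (j : ℕ) : binomCdf D γ j ≤ 1 := by
  rw [← binomCdf_eq_one D γ (le_max_left D j)]
  exact binomCdf_mono D h0 h1 (le_max_right D j)

variable {γ B η L : ℝ}

theorem binomPmf_upper_tail {D : ℕ} (h0 : 0 < γ) (h1 : γ < 1) (hη0 : 0 < η) (hη : η ≤ 1 / 2)
    (hDB : (D : ℝ) ≤ B) (hL : 3 * L + 1 ≤ η ^ 2 * (γ * B) / 2) {k : ℕ}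
    (hk : (1 + 2 * η) * (γ * B) ≤ k) : binomPmf D γ k ≤ Real.exp (-3 * L) := by
  simpa [sum_binomPmf] using
    (nearBinom_binomPmf D h0.le h1.le).upper_tail h0 h1 hη0 hη (by linarith) hDB hL hk

theorem binomPmf_lower_tail {D : ℕ} (h0 : 0 < γ) (h1 : γ < 1) (hη0 : 0 < η) (hη : η ≤ 1 / 2)
    (hB : 0 ≤ B) (hDB : B ≤ D) (hL : 3 * L + 1 ≤ η ^ 2 * (γ * B) / 2) {k : ℕ}
    (hk : (k : ℝ) ≤ (1 - 2 * η) * (γ * B)) : binomPmf D γ k ≤ Real.exp (-3 * L) := by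
  simpa [sum_binomPmf] using
    (nearBinom_binomPmf D h0.le h1.le).lower_tail h0 h1 hη0 hη (by linarith) hB hDB hL hk

/-- The first value counted is j+1, so the threshold is imposed on j+1; this lets `j` be a
rounded-down threshold. -/
theorem one_sub_binomCdf_le {D : ℕ} (h0 : 0 < γ) (h1 : γ < 1) (hη0 : 0 < η) (hη : η ≤ 1 / 2)
    (hDB : (D : ℝ) ≤ B) (hL : 3 * L + 1 ≤ η ^ 2 * (γ * B) / 2) {j : ℕ}
    (hj : (1 + 2 * η) * (γ * B) ≤ (j : ℝ) + 1) :
    1 - binomCdf D γ j ≤ ((D : ℝ) + 1) * Real.exp (-3 * L) := by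
  have hsplit : (1 : ℝ) ≤ binomCdf D γ j + ∑ k ∈ (range (D + 1)).filter (fun k => j < k),
      binomPmf D γ k := by
    rw [← sum_binomPmf D γ, ← sum_filter_add_sum_filter_not (range (D + 1)) (fun k => j < k),
      add_comm]
    gcongr
    refine sum_le_sum_of_subset_of_nonneg (fun k hk => ?_)
      fun k _ _ => binomPmf_nonneg D h0.le h1.le k
    simp only [mem_filter, mem_range] at hk ⊢
    omega
  have : ∑ k ∈ (range (D + 1)).filter (fun k => j < k), binomPmf D γ k ≤
      ((D : ℝ) + 1) * Real.exp (-3 * L) := by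
    refine (sum_le_card_nsmul _ _ (Real.exp (-3 * L)) fun k hk => ?_).trans ?_
    · refine binomPmf_upper_tail h0 h1 hη0 hη hDB hL (hj.trans ?_)
      exact_mod_cast (mem_filter.1 hk).2
    · rw [nsmul_eq_mul]
      gcongr
      exact_mod_cast (card_filter_le _ _).trans (card_range _).le
  linarith

theorem binomCdf_le {D : ℕ} (h0 : 0 < γ) (h1 : γ < 1) (hη0 : 0 < η) (hη : η ≤ 1 / 2)
    (hB : 0 ≤ B) (hDB : B ≤ D) (hL : 3 * L + 1 ≤ η ^ 2 * (γ * B) / 2) {j : ℕ}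
    (hj : (j : ℝ) ≤ (1 - 2 * η) * (γ * B)) :
    binomCdf D γ j ≤ ((D : ℝ) + 1) * Real.exp (-3 * L) := by
  have hγB : 0 ≤ γ * B := by positivity
  have hjD : (j : ℝ) ≤ D := by nlinarith
  refine (sum_le_card_nsmul (range (j + 1)) (binomPmf D γ) (Real.exp (-3 * L))
    fun k hk => ?_).trans ?_
  · refine binomPmf_lower_tail h0 h1 hη0 hη hB hDB hL (le_trans ?_ hj)
    exact_mod_cast Nat.lt_succ_iff.1 (mem_range.1 hk)
  · rw [nsmul_eq_mul, card_range]
    push_cast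
    gcongr

theorem sum_vtx (S : Finset (Fin n)) (f : Fin n → ℝ) :
    ∑ v ∈ S, f v = ∑ l : Fin S.card, f (vtx S l) := by
  have h : S = univ.map (S.orderEmbOfFin rfl).toEmbedding := by
    rw [map_eq_image, ← coe_inj]
    simp
  conv_lhs => rw [h]
  rw [sum_map]
  rfl

theorem vtx_mono (S : Finset (Fin n)) : Monotone (vtx S) := (S.orderEmbOfFin rfl).monotone

/-- By monotonicity the vertices up to position `k` all have degree at most `B`, so at the threshold
`j` their distribution functions are almost 1. The total deficit is at most 1/2, which the rounding
in N(j) absorbs, so N(j) ≥ k+1. -/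
theorem modelSeq_le (hd : Monotone d) (h0 : 0 < gam d S) (h1 : gam d S < 1) (hη0 : 0 < η)
    (hη : η ≤ 1 / 2) (hL : 3 * L + 1 ≤ η ^ 2 * (gam d S * B) / 2)
    (hE : ∑ v ∈ S, ((d v : ℝ) + 1) * Real.exp (-3 * L) ≤ 1 / 2) {k : Fin S.card}
    (hB : (d (vtx S k) : ℝ) ≤ B) : (modelSeq d S k : ℝ) ≤ (1 + 2 * η) * (gam d S * B) := by
  have hB0 : 0 ≤ B := (Nat.cast_nonneg _).trans hB
  have hpos : 0 ≤ (1 + 2 * η) * (gam d S * B) := by positivity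
  have hfl := Nat.lt_floor_add_one ((1 + 2 * η) * (gam d S * B))
  refine le_trans (Nat.cast_le.2 ((modelSeq_le_iff d S k _).2 ?_)) (Nat.floor_le hpos)
  set j := ⌊(1 + 2 * η) * (gam d S * B)⌋₊
  unfold modelN
  rw [← Nat.add_one_le_iff, Nat.le_floor_iff (by
    have := sum_nonneg fun v (_ : v ∈ S) => binomCdf_nonneg (d v) h0.le h1.le j
    linarith)]
  rw [sum_vtx] at hE ⊢
  have key : ∀ l : Fin S.card, (if l ≤ k then (1 : ℝ) else 0) -
      ((d (vtx S l) : ℝ) + 1) * Real.exp (-3 * L) ≤ binomCdf (d (vtx S l)) (gam d S) j := by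
    intro l
    by_cases hl : l ≤ k
    · have hdl : (d (vtx S l) : ℝ) ≤ B :=
        (Nat.cast_le.2 (hd (vtx_mono S hl))).trans hB
      have := one_sub_binomCdf_le h0 h1 hη0 hη hdl hL hfl.le
      rw [if_pos hl]
      linarith
    · rw [if_neg hl]
      have h2 : 0 ≤ ((d (vtx S l) : ℝ) + 1) * Real.exp (-3 * L) := by positivity
      have := binomCdf_nonneg (d (vtx S l)) h0.le h1.le j
      linarith
  have hsum := sum_le_sum fun l (_ : l ∈ (univ : Finset (Fin S.card))) => key l
  rw [sum_sub_distrib] at hsum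
  have hcard : ∑ l : Fin S.card, (if l ≤ k then (1 : ℝ) else 0) = (k : ℕ) + 1 := by
    rw [sum_boole]
    have : (univ.filter fun l => l ≤ k) = Iic k := by ext; simp
    rw [this, Fin.card_Iic]
    push_cast
    rfl
  rw [hcard] at hsum
  push_cast
  linarith

/-- Below the threshold the vertices from position `k` onwards contribute less than 1/2 in total,
and the `k` earlier ones at most 1 each, so N(j) ≤ k. -/
theorem le_modelSeq (hd : Monotone d) (h0 : 0 < gam d S) (h1 : gam d S < 1) (hη0 : 0 < η)
    (hη : η ≤ 1 / 2) (hL : 3 * L + 1 ≤ η ^ 2 * (gam d S * B) / 2)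
    (hE : ∑ v ∈ S, ((d v : ℝ) + 1) * Real.exp (-3 * L) < 1 / 2) (hB0 : 0 ≤ B) {k : Fin S.card}
    (hB : B ≤ (d (vtx S k) : ℝ)) : (1 - 2 * η) * (gam d S * B) ≤ (modelSeq d S k : ℝ) := by
  by_contra! hlt
  have hk := (modelSeq_le_iff d S k _).1 le_rfl
  set j := modelSeq d S k
  revert hk
  unfold modelN
  -- The claim becomes: sum + 1/2 < k + 1. Hence the strict inequality in `hE`.
  rw [imp_false, not_lt, ← Nat.lt_add_one_iff, Nat.floor_lt (by
    have := sum_nonneg fun v (_ : v ∈ S) => binomCdf_nonneg (d v) h0.le h1.le j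
    linarith)]
  rw [sum_vtx] at hE ⊢
  have key : ∀ l : Fin S.card, binomCdf (d (vtx S l)) (gam d S) j ≤
      (if l < k then (1 : ℝ) else 0) + ((d (vtx S l) : ℝ) + 1) * Real.exp (-3 * L) := by
    intro l
    by_cases hl : l < k
    · rw [if_pos hl]
      have h2 : 0 ≤ ((d (vtx S l) : ℝ) + 1) * Real.exp (-3 * L) := by positivity
      have := binomCdf_le_one (d (vtx S l)) h0.le h1.le j
      linarith
    · have hdl : B ≤ (d (vtx S l) : ℝ) :=
        hB.trans (Nat.cast_le.2 (hd (vtx_mono S (not_lt.1 hl))))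
      rw [if_neg hl, zero_add]
      exact binomCdf_le h0 h1 hη0 hη hB0 hdl hL hlt.le
  have hsum := sum_le_sum fun l (_ : l ∈ (univ : Finset (Fin S.card))) => key l
  rw [sum_add_distrib] at hsum
  have hcard : ∑ l : Fin S.card, (if l < k then (1 : ℝ) else 0) = (k : ℕ) := by
    rw [sum_boole]
    have : (univ.filter fun l => l < k) = Iio k := by ext; simp
    rw [this, Fin.card_Iio]
  rw [hcard] at hsum
  push_cast
  linarith

theorem abs_modelN_sub_le (d : Fin n → ℕ) (S : Finset (Fin n)) (k : ℕ) :
    |(modelN d S k : ℝ) - ∑ v ∈ S, binomCdf (d v) (gam d S) k| ≤ 1 / 2 := by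
  have h := sum_nonneg fun v (_ : v ∈ S) => binomCdf_nonneg (d v) (gam_nonneg d S) (gam_le_one d S) k
  unfold modelN
  have h1 := Nat.floor_le (by linarith : 0 ≤ (∑ v ∈ S, binomCdf (d v) (gam d S) k) + 1 / 2)
  have h2 := Nat.lt_floor_add_one ((∑ v ∈ S, binomCdf (d v) (gam d S) k) + 1 / 2)
  rw [abs_le]
  constructor <;> linarith

/-- The count is a difference of two values of N, each within 1/2 of the unrounded sum; consecutive
sums differ by the point masses. -/
theorem abs_entryCount_modelSeq_sub_le (d : Fin n → ℕ) (S : Finset (Fin n)) (i : ℕ) :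
    |(entryCount (modelSeq d S) i : ℝ) - ∑ v ∈ S, binomPmf (d v) (gam d S) i| ≤ 1 := by
  rcases i with _ | i
  · have h := abs_modelN_sub_le d S 0
    have e : ∀ v, binomCdf (d v) (gam d S) 0 = binomPmf (d v) (gam d S) 0 := fun v => by
      simp [binomCdf, binomPmf]
    simp only [e] at h
    rw [entryCount_modelSeq_zero]
    linarith
  · have h1 := abs_le.1 (abs_modelN_sub_le d S i)
    have h2 := abs_le.1 (abs_modelN_sub_le d S (i + 1))
    have e : ∀ v, binomCdf (d v) (gam d S) (i + 1) =
        binomCdf (d v) (gam d S) i + binomPmf (d v) (gam d S) (i + 1) := fun v =>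
      sum_range_succ _ _
    simp only [e, sum_add_distrib] at h2
    have h3 : (entryCount (modelSeq d S) (i + 1) : ℝ) = modelN d S (i + 1) - modelN d S i := by
      exact_mod_cast entryCount_modelSeq_succ d S i
    rw [h3, abs_le]
    constructor <;> linarith

theorem inducedSeq_eq (G : SimpleGraph (Fin n)) (S : Finset (Fin n)) (k : Fin S.card) :
    inducedSeq G S k = (nb G (vtx S k) ∩ S).card := by
  unfold inducedSeq
  rw [← Set.ncard_coe_finset, ← Set.ncard_image_of_injective _ Subtype.val_injective]
  congr 1
  ext w
  simp only [Set.mem_image, SimpleGraph.mem_neighborSet, SimpleGraph.comap_adj,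
    Function.Embedding.subtype_apply, Subtype.exists, coe_inter, Set.mem_inter_iff, mem_coe,
    mem_nb]
  constructor
  · rintro ⟨a, ha, h, rfl⟩
    exact ⟨h, ha⟩
  · rintro ⟨h, hw⟩
    exact ⟨w, hw, h, rfl⟩

theorem entryCount_inducedSeq (G : SimpleGraph (Fin n)) (S : Finset (Fin n)) (i : ℕ) :
    entryCount (inducedSeq G S) i = degCount G S S i := by
  have := sum_vtx S fun v => if (nb G v ∩ S).card = i then (1 : ℝ) else 0
  rw [sum_boole, sum_boole] at this
  unfold entryCount degCount
  simp only [inducedSeq_eq]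
  exact_mod_cast this.symm

end Model
-- Existence of a graph with the prescribed degrees.
section Existence

variable {n : ℕ}

theorem card_nb_sup_edge {G : SimpleGraph (Fin n)} {a b : Fin n} (hab : a ≠ b)
    (h : ¬ G.Adj a b) (z : Fin n) : (nb (G ⊔ SimpleGraph.edge a b) z).card =
      (nb G z).card + (if z = a then 1 else 0) + (if z = b then 1 else 0) := by
  have hadj : ∀ y, (G ⊔ SimpleGraph.edge a b).Adj z y ↔
      G.Adj z y ∨ (z = a ∧ y = b ∨ z = b ∧ y = a) := by
    intro y
    rw [SimpleGraph.sup_adj, SimpleGraph.edge_adj]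
    grind
  by_cases ha : z = a
  · subst ha
    have : nb (G ⊔ SimpleGraph.edge z b) z = insert b (nb G z) := by
      ext y; simp only [mem_nb, hadj, mem_insert]; grind
    rw [this, card_insert_of_notMem (by simpa)]
    simp [hab]
  by_cases hb : z = b
  · subst hb
    have : nb (G ⊔ SimpleGraph.edge a z) z = insert a (nb G z) := by
      ext y; simp only [mem_nb, hadj, mem_insert]; grind
    rw [this, card_insert_of_notMem (by simpa [G.adj_comm] using h)]
    simp [ha]
  have : nb (G ⊔ SimpleGraph.edge a b) z = nb G z := by
    ext y; simp only [mem_nb, hadj]; grind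
  rw [this]
  simp [ha, hb]

theorem even_sum_card_nb (G : SimpleGraph (Fin n)) : Even (∑ v, (nb G v).card) := by
  classical
  have h := G.sum_degrees_eq_twice_card_edges
  have e : ∀ v, G.degree v = (nb G v).card := by
    intro v
    rw [← SimpleGraph.card_neighborFinset_eq_degree]
    congr 1
    ext w
    simp
  simp only [e] at h
  rw [h]
  exact even_two_mul _

/-- Moving one edge raises the degrees of two given vertices, or of one vertex by `2`. -/
theorem exists_raise {G : SimpleGraph (Fin n)} {u v x y : Fin n} (huv : u = v ∨ G.Adj u v)
    (hxy : G.Adj x y) (hx : x ∉ insert u (nb G u)) (hy : y ∉ insert v (nb G v)) :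
    ∃ G' : SimpleGraph (Fin n), ∀ z, (nb G' z).card =
      (nb G z).card + (if z = u then 1 else 0) + (if z = v then 1 else 0) := by
  simp only [mem_insert, mem_nb, not_or] at hx hy
  have hne := hxy.ne
  set H := G \ SimpleGraph.edge x y
  have hHG : ∀ a b, H.Adj a b → G.Adj a b := fun a b h => h.1
  have hG : H ⊔ SimpleGraph.edge x y = G := by
    refine sdiff_sup_cancel fun a b h => ?_
    rw [SimpleGraph.edge_adj] at h
    rcases h.1 with ⟨rfl, rfl⟩ | ⟨rfl, rfl⟩
    · exact hxy
    · exact hxy.symm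
  have hHxy : ¬ H.Adj x y := by
    rintro ⟨_, h⟩
    exact h ((SimpleGraph.edge_adj ..).2 ⟨Or.inl ⟨rfl, rfl⟩, hne⟩)
  have hHux : ¬ H.Adj u x := fun h => hx.2 (hHG _ _ h)
  have hvy : ¬ (H ⊔ SimpleGraph.edge u x).Adj v y := by
    rw [SimpleGraph.sup_adj, SimpleGraph.edge_adj]
    rintro (h | ⟨⟨rfl, rfl⟩ | ⟨rfl, rfl⟩, -⟩)
    · exact hy.2 (hHG _ _ h)
    · exact hne rfl
    · rcases huv with rfl | h
      · exact hx.1 rfl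
      · exact hx.2 h
  refine ⟨(H ⊔ SimpleGraph.edge u x) ⊔ SimpleGraph.edge v y, fun z => ?_⟩
  have h1 := card_nb_sup_edge hne hHxy z
  rw [hG] at h1
  rw [card_nb_sup_edge (Ne.symm hy.1) hvy, card_nb_sup_edge (Ne.symm hx.1) hHux, h1]
  omega

theorem exists_adj_avoiding {G : SimpleGraph (Fin n)} {A B : Finset (Fin n)}
    (h : ∑ a ∈ A, (nb G a).card + ∑ b ∈ B, (nb G b).card < ∑ v, (nb G v).card) :
    ∃ x y, G.Adj x y ∧ x ∉ A ∧ y ∉ B := by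
  classical
  by_contra! hcon
  rw [← card_pairs G univ, ← card_pairs G A, ← card_pairs_swap G B] at h
  refine absurd (card_le_card ?_) (not_le.2 (lt_of_le_of_lt (card_union_le _ _) h))
  rintro ⟨x, y⟩ hxy
  simp only [mem_filter, mem_univ, true_and, mem_union] at hxy ⊢
  have := hcon x y hxy
  tauto

/-- Among graphs with degrees at most `d`, take one with the largest degree sum. Any two deficient
vertices are adjacent, since otherwise an edge could be added; so all of them lie in one closed
neighbourhood and the total deficiency is at most (Δ+1)Δ. If there is a deficiency, parity yields
two deficient vertices or one of deficiency at least 2, and rerouting a remote edge xy into `ux` and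
`vy` contradicts maximality. -/
theorem graphs_nonempty {d : Fin n → ℕ} (heven : Even (totalM d)) (hd : 1 ≤ maxDeg d)
    (hM : 6 * maxDeg d ^ 2 < totalM d) : (graphs d).Nonempty := by
  classical
  set Δ := maxDeg d
  obtain ⟨G, hG, hmax⟩ := exists_max_image
    (univ.filter fun G : SimpleGraph (Fin n) => ∀ v, (nb G v).card ≤ d v)
    (fun G => ∑ v, (nb G v).card) ⟨⊥, by
      rw [mem_filter]
      exact ⟨mem_univ _, fun v => by simp [nb]⟩⟩
  simp only [mem_filter, mem_univ, true_and] at hG hmax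
  have hle : ∀ v, (nb G v).card ≤ Δ := fun v => (hG v).trans (le_maxDeg d v)
  have hraise : ∀ u v, (nb G u).card < d u → (nb G v).card < d v →
      (u = v → (nb G u).card + 2 ≤ d u) → ¬ ∃ G' : SimpleGraph (Fin n), ∀ z, (nb G' z).card =
      (nb G z).card + (if z = u then 1 else 0) + (if z = v then 1 else 0) := by
    rintro u v hu hv huv ⟨G', hG'⟩
    have h1 := hmax G' fun z => by
      rw [hG' z]
      have := hG z
      by_cases e1 : z = u
      · by_cases e2 : z = v
        · have := huv (e1.symm.trans e2)
          subst e1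
          simp only [if_true, e2]
          subst e2
          omega
        · subst e1; simp only [if_true, e2, if_false]; omega
      · by_cases e2 : z = v
        · subst e2; simp only [if_true, e1, if_false]; omega
        · simp only [e1, e2, if_false]; omega
    simp only [hG', sum_add_distrib, sum_ite_eq', mem_univ, if_true] at h1
    omega
  have hadj : ∀ u v, (nb G u).card < d u → (nb G v).card < d v → u = v ∨ G.Adj u v := by
    intro u v hu hv
    by_contra! hcon
    exact hraise u v hu hv (fun e => absurd e hcon.1)
      ⟨_, card_nb_sup_edge hcon.1 hcon.2⟩
  refine ⟨G, mem_graphs.2 ?_⟩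
  by_contra! hcon
  obtain ⟨u, hu⟩ := hcon
  have hu : (nb G u).card < d u := lt_of_le_of_ne (hG u) hu
  have hins : ∀ v, (insert v (nb G v)).card ≤ Δ + 1 := fun v =>
    (card_insert_le _ _).trans (by have := hle v; omega)
  have hsum : ∀ v, ∑ w ∈ insert v (nb G v), (nb G w).card ≤ (Δ + 1) * Δ := fun v => by
    refine (sum_le_card_nsmul _ _ Δ fun y _ => hle y).trans ?_
    rw [smul_eq_mul]
    exact Nat.mul_le_mul_right _ (hins v)
  have htot : totalM d ≤ ∑ v, (nb G v).card + (Δ + 1) * Δ := by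
    have e1 : totalM d ≤ ∑ v, ((nb G v).card + if v ∈ insert u (nb G u) then d v else 0) := by
      unfold totalM totalDeg
      refine sum_le_sum fun v _ => ?_
      by_cases hv : (nb G v).card < d v
      · have : v ∈ insert u (nb G u) := by
          rcases hadj u v hu hv with rfl | h
          · simp
          · simp [h]
        rw [if_pos this]
        omega
      · omega
    rw [sum_add_distrib, sum_ite_mem, univ_inter] at e1
    refine e1.trans (Nat.add_le_add_left ?_ _)
    refine (sum_le_card_nsmul _ _ Δ fun y _ => le_maxDeg d y).trans ?_
    rw [smul_eq_mul]
    exact Nat.mul_le_mul_right _ (hins u)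
  -- Otherwise `u` is the only deficient vertex and lacks exactly 1, so M is one more than an even
  -- degree sum.
  obtain ⟨v, hv, huv⟩ : ∃ v, (nb G v).card < d v ∧ (u = v → (nb G u).card + 2 ≤ d u) := by
    by_contra! hcon
    have hu1 : (nb G u).card + 1 = d u := by
      have := (hcon u hu).2
      omega
    have hdv : ∀ v, d v = (nb G v).card + if v = u then 1 else 0 := by
      intro v
      by_cases e : v = u
      · subst e; rw [if_pos rfl, hu1]
      · rw [if_neg e, add_zero]
        by_contra hne
        exact e (hcon v (lt_of_le_of_ne (hG v) (Ne.symm hne))).1.symm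
    have : totalM d = ∑ v, (nb G v).card + 1 := by
      unfold totalM totalDeg
      rw [sum_congr rfl fun v _ => hdv v, sum_add_distrib]
      simp
    rw [this] at heven
    have := even_sum_card_nb G
    grind
  have hbound : (Δ + 1) * Δ ≤ 2 * Δ ^ 2 := by nlinarith
  -- The degree sum exceeds 6Δ² - 2Δ² = 4Δ², while the two closed neighbourhoods together account
  -- for at most 2(Δ+1)Δ ≤ 4Δ².
  obtain ⟨x, y, hxy, hx, hy⟩ := exists_adj_avoiding (G := G) (A := insert u (nb G u))
    (B := insert v (nb G v)) (by have := hsum u; have := hsum v; omega)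
  exact hraise u v hu hv huv (exists_raise (hadj u v hu hv) hxy hx hy)

end Existence
-- The estimates at the scales of the theorem.
section Main

variable {n : ℕ}

/-- The ranges of the parameters in the main estimate, with `x = δ ^ (1 / 64)` and
`L = log M`. -/
structure Scales (d : Fin n → ℕ) (S : Finset (Fin n)) (x L J : ℝ) : Prop where
  mono : Monotone d
  one_le : ∀ v, 1 ≤ d v
  nonempty : S.Nonempty
  x_pos : 0 < x
  x_le : x ≤ 1 / 100
  L_le : 100 ≤ L
  exp_L : Real.exp L = totalM d
  J_eq : gam d S * J = L / x ^ 4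
  gam_lt : gam d S < 1 - 6 * x ^ 16
  degree : (maxDeg d : ℝ) ^ 2 * J ^ 12 ≤ x ^ 16 * (gam d S * totalM d)

namespace Scales

variable {d : Fin n → ℕ} {S : Finset (Fin n)} {x L J : ℝ}

theorem totalM_ge (h : Scales d S x L J) : L ≤ totalM d := by
  have := Real.add_one_le_exp L
  rw [h.exp_L] at this
  linarith

theorem totalM_pos (h : Scales d S x L J) : 0 < (totalM d : ℝ) :=
  lt_of_lt_of_le (by linarith [h.L_le]) h.totalM_ge

theorem gam_pos (h : Scales d S x L J) : 0 < gam d S := by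
  obtain ⟨v, hv⟩ := h.nonempty
  have h1 : 0 < totalDeg d S := sum_pos (fun v _ => h.one_le v) ⟨v, hv⟩
  have h2 := h.totalM_pos
  unfold gam
  positivity

theorem gam_lt_one (h : Scales d S x L J) : gam d S < 1 := by
  have := h.gam_lt
  have := h.x_pos
  have : 0 < x ^ 16 := by positivity
  linarith

theorem gam_mul_J (h : Scales d S x L J) : 1000 * L ≤ gam d S * J := by
  have h1 := h.x_pos
  have h2 := h.L_le
  have hx : x ^ 4 ≤ (1 / 100 : ℝ) ^ 4 := pow_le_pow_left₀ h1.le h.x_le 4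
  rw [h.J_eq, le_div_iff₀ (by positivity)]
  nlinarith

theorem J_pos (h : Scales d S x L J) : 0 < J := by
  have := h.gam_mul_J
  have := h.L_le
  exact pos_of_mul_pos_right (by linarith) h.gam_pos.le

theorem gam_mul_J_le (h : Scales d S x L J) : gam d S * J ≤ J :=
  mul_le_of_le_one_left h.J_pos.le h.gam_lt_one.le

theorem J_ge (h : Scales d S x L J) : 100000 ≤ J := by
  have h1 := h.gam_mul_J
  have h2 := h.L_le
  have h3 := h.gam_mul_J_le
  linarith

theorem one_le_J_mul_x (h : Scales d S x L J) : 1 ≤ J * x := by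
  have h1 := h.x_pos
  have h2 := h.L_le
  have h3 := h.gam_mul_J_le
  rw [h.J_eq, div_le_iff₀ (by positivity)] at h3
  have hx : x ^ 3 ≤ 1 := pow_le_one₀ h1.le (by linarith [h.x_le])
  have h4 := mul_pos h.J_pos h1
  nlinarith

theorem one_le_maxDeg (h : Scales d S x L J) : 1 ≤ maxDeg d := by
  obtain ⟨v, hv⟩ := h.nonempty
  exact (h.one_le v).trans (le_maxDeg d v)

/-- The degree hypothesis gives Δ² ≤ x¹⁶ J⁻¹² γM. The spare factor x¹⁶ absorbs the constant 6 and,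
on the complement side, the factor 1-γ > 6x¹⁶. -/
theorem goodError (h : Scales d S x L J) : GoodError d S (J ^ 12)⁻¹ where
  one_le_maxDeg := h.one_le_maxDeg
  totalM_pos := h.totalM_pos
  gam_pos := h.gam_pos
  gam_lt_one := h.gam_lt_one
  nonneg := by have := h.J_pos; positivity
  le_one := inv_le_one_of_one_le₀ (one_le_pow₀ (by linarith [h.J_ge]))
  le_in := by
    have hJ := h.J_pos
    have hM := mul_pos h.gam_pos h.totalM_pos
    have hx0 := h.x_pos
    have hx : 6 * x ^ 16 ≤ 1 := by linarith [h.gam_lt, h.gam_pos]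
    rw [inv_mul_eq_div, le_div_iff₀ (by positivity)]
    nlinarith [h.degree]
  le_out := by
    have hJ := h.J_pos
    have hM := h.totalM_pos
    have hx0 := h.x_pos
    have hx : 6 * x ^ 16 ≤ 1 - gam d S := by linarith [h.gam_lt]
    have hg : x ^ 16 * (gam d S * totalM d) ≤ x ^ 16 * totalM d := by
      gcongr
      exact mul_le_of_le_one_left hM.le h.gam_lt_one.le
    rw [inv_mul_eq_div, le_div_iff₀ (by positivity)]
    nlinarith [h.degree]

theorem maxDeg_sq_le (h : Scales d S x L J) : (maxDeg d : ℝ) ^ 2 * J ^ 12 ≤ totalM d := by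
  have hM := h.totalM_pos
  have hx : x ^ 16 ≤ 1 := pow_le_one₀ h.x_pos.le (by linarith [h.x_le])
  have hg : gam d S * totalM d ≤ totalM d := mul_le_of_le_one_left hM.le h.gam_lt_one.le
  have := mul_le_mul hx hg (mul_nonneg h.gam_pos.le hM.le) zero_le_one
  linarith [h.degree]

theorem eight_maxDeg_sq_lt (h : Scales d S x L J) : 8 * (maxDeg d : ℝ) ^ 2 < totalM d := by
  have h1 := h.maxDeg_sq_le
  have h2 : (8 : ℝ) < J ^ 12 := by
    have : J ^ 1 ≤ J ^ 12 := pow_le_pow_right₀ (by linarith [h.J_ge]) (by norm_num)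
    linarith [h.J_ge]
  have h3 : (1 : ℝ) ≤ maxDeg d := by exact_mod_cast h.one_le_maxDeg
  have h4 : (0 : ℝ) < (maxDeg d : ℝ) ^ 2 := by positivity
  have := mul_lt_mul_of_pos_left h2 h4
  linarith

theorem J_pow_le (h : Scales d S x L J) : J ^ 12 ≤ totalM d := by
  have h1 := h.maxDeg_sq_le
  have h3 : (1 : ℝ) ≤ maxDeg d := by exact_mod_cast h.one_le_maxDeg
  have : (1 : ℝ) ≤ (maxDeg d : ℝ) ^ 2 := one_le_pow₀ h3
  have := pow_pos h.J_pos 12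
  nlinarith

theorem error_le (h : Scales d S x L J) : (J ^ 12)⁻¹ ≤ x := by
  have h1 := h.one_le_J_mul_x
  have h2 := h.J_pos
  have h3 : J ^ 1 ≤ J ^ 12 := pow_le_pow_right₀ (by linarith [h.J_ge]) (by norm_num)
  have h4 := h.x_pos
  rw [inv_le_iff_one_le_mul₀ (by positivity)]
  nlinarith

theorem sum_tail_le (h : Scales d S x L J) :
    ∑ v ∈ S, ((d v : ℝ) + 1) * Real.exp (-3 * L) ≤ 2 * totalM d * Real.exp (-3 * L) := by
  rw [← sum_mul]
  gcongr
  calc ∑ v ∈ S, ((d v : ℝ) + 1) ≤ ∑ v ∈ S, 2 * (d v : ℝ) := by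
        refine sum_le_sum fun v _ => ?_
        have : (1 : ℝ) ≤ d v := by exact_mod_cast h.one_le v
        linarith
    _ = 2 * (totalDeg d S : ℝ) := by rw [← mul_sum]; simp [totalDeg]
    _ ≤ _ := by
        gcongr
        exact sum_le_sum_of_subset (subset_univ S)

/-- Since exp L = M, the left side is 2M⁻². -/
theorem tail_le (h : Scales d S x L J) : 2 * totalM d * Real.exp (-3 * L) ≤ 1 / L := by
  have h1 := h.totalM_ge
  have h2 := h.L_le
  have h3 := h.totalM_pos
  have e : Real.exp (-3 * L) = ((totalM d : ℝ) ^ 3)⁻¹ := by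
    rw [← h.exp_L, ← Real.exp_nat_mul, ← Real.exp_neg]
    congr 1
    push_cast
    ring
  rw [e, ← div_eq_mul_inv, div_le_div_iff₀ (by positivity) (by linarith)]
  have : (2 : ℝ) * L ≤ totalM d ^ 2 := by nlinarith
  nlinarith

theorem sum_tail_lt (h : Scales d S x L J) :
    ∑ v ∈ S, ((d v : ℝ) + 1) * Real.exp (-3 * L) < 1 / 2 := by
  have h2 := h.L_le
  refine (h.sum_tail_le.trans h.tail_le).trans_lt ?_
  rw [div_lt_div_iff₀ (by linarith) (by norm_num)]
  linarith

/-- Here γD ≥ L/x², so η = 5x/2 makes the right side at least 25L/8, which exceeds 3L+1 for L ≥ 100.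
This is the source of the deviations 2η = 5x in `Atypical`. -/
theorem exponent_large (h : Scales d S x L J) {D : ℝ} (hD : x ^ 2 * J ≤ D) :
    3 * L + 1 ≤ (5 / 2 * x) ^ 2 * (gam d S * D) / 2 := by
  have h1 := h.x_pos
  have h2 := h.L_le
  have h3 : L / x ^ 2 ≤ gam d S * D := by
    calc L / x ^ 2 = x ^ 2 * (L / x ^ 4) := by field_simp
      _ = gam d S * (x ^ 2 * J) := by rw [← h.J_eq]; ring
      _ ≤ _ := mul_le_mul_of_nonneg_left hD h.gam_pos.le
  rw [div_le_iff₀ (by positivity)] at h3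
  nlinarith

theorem exponent_small (h : Scales d S x L J) :
    3 * L + 1 ≤ (1 / 2) ^ 2 * (gam d S * (x ^ 2 * J)) / 2 := by
  have h1 := h.x_pos
  have h2 := h.L_le
  have hx : x ^ 2 ≤ (1 / 100 : ℝ) ^ 2 := pow_le_pow_left₀ h1.le h.x_le 2
  have h3 : gam d S * (x ^ 2 * J) = L / x ^ 2 := by
    calc _ = x ^ 2 * (L / x ^ 4) := by rw [← h.J_eq]; ring
      _ = _ := by field_simp
  have h4 : 10000 * L ≤ L / x ^ 2 := by
    rw [le_div_iff₀ (by positivity)]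
    nlinarith
  rw [h3]
  linarith

theorem exponent_cutoff (h : Scales d S x L J) :
    3 * L + 1 ≤ (1 / 4) ^ 2 * (gam d S * J) / 2 := by
  have h1 := h.gam_mul_J
  have h2 := h.L_le
  linarith

theorem x_sq_J_le (h : Scales d S x L J) : x ^ 2 * J ≤ J :=
  mul_le_of_le_one_left h.J_pos.le (pow_le_one₀ h.x_pos.le (by linarith [h.x_le]))

/-- The values of `d_S` at `v` that are far from what is expected. -/
def Atypical (d : Fin n → ℕ) (S : Finset (Fin n)) (x J : ℝ) (v : Fin n) (k : ℕ) : Prop :=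
  (x ^ 2 * J ≤ d v ∧ ((1 + 5 * x) * (gam d S * d v) ≤ k ∨ (k : ℝ) ≤ (1 - 5 * x) * (gam d S * d v)))
    ∨ ((d v : ℝ) ≤ x ^ 2 * J ∧ 2 * (gam d S * (x ^ 2 * J)) ≤ k)

theorem fiberCount_le_of_atypical (h : Scales d S x L J) (v : Fin n) (k : ℕ)
    (hk : Atypical d S x J v k) :
    fiberCount (graphs d) v S k ≤ Real.exp (-3 * L) * (graphs d).card := by
  have hn := h.goodError.nearBinom v
  have hx := h.x_pos
  have hx' := h.x_le
  have he := h.error_le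
  rw [← GoodError.sum_fiberCount_graphs (S := S) v]
  rcases hk with ⟨hd, hk | hk⟩ | ⟨hd, hk⟩
  · exact hn.upper_tail h.gam_pos h.gam_lt_one (η := 5 / 2 * x) (by positivity) (by linarith)
      (by
        have h1 := h.one_le_J_mul_x
        have h2 := h.J_ge
        rw [inv_le_iff_one_le_mul₀ (by positivity)]
        have h3 : J ^ 2 ≤ J ^ 12 := pow_le_pow_right₀ (by linarith) (by norm_num)
        have h4 : 100000 ≤ J ^ 2 * x := by nlinarith
        nlinarith) le_rfl (h.exponent_large hd) (by linarith)
  · exact hn.lower_tail h.gam_pos h.gam_lt_one (η := 5 / 2 * x) (by positivity) (by linarith)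
      (by
        have h1 := h.one_le_J_mul_x
        have h2 := h.J_ge
        rw [inv_le_iff_one_le_mul₀ (by positivity)]
        have h3 : J ^ 2 ≤ J ^ 12 := pow_le_pow_right₀ (by linarith) (by norm_num)
        have h4 : 100000 ≤ J ^ 2 * x := by nlinarith
        nlinarith) (Nat.cast_nonneg _) le_rfl (h.exponent_large hd) (by linarith)
  · exact hn.upper_tail h.gam_pos h.gam_lt_one (η := 1 / 2) (by norm_num) le_rfl (by linarith)
      hd h.exponent_small (by linarith)

open Classical in
theorem card_atypical_le (h : Scales d S x L J) :
    (((graphs d).filter fun G => ∃ v ∈ S, Atypical d S x J v (nb G v ∩ S).card).card : ℝ) ≤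
      1 / L * (graphs d).card := by
  have hsub : ((graphs d).filter fun G => ∃ v ∈ S, Atypical d S x J v (nb G v ∩ S).card) ⊆
      S.biUnion fun v => (graphs d).filter fun G => Atypical d S x J v (nb G v ∩ S).card := by
    intro G
    simp only [mem_filter, mem_biUnion]
    grind
  calc _ ≤ ∑ v ∈ S, (((graphs d).filter fun G =>
        Atypical d S x J v (nb G v ∩ S).card).card : ℝ) := by
        exact_mod_cast (card_le_card hsub).trans card_biUnion_le
    _ ≤ ∑ v ∈ S, ((d v : ℝ) + 1) * Real.exp (-3 * L) * (graphs d).card :=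
        sum_le_sum fun v _ => card_filter_degree_le (h.fiberCount_le_of_atypical v)
          (Real.exp_pos _).le
    _ ≤ _ := by
        rw [← sum_mul]
        gcongr
        exact h.sum_tail_le.trans h.tail_le

/-- The vertices of `S` whose degree is at most the cut-off. -/
noncomputable def lowPart (d : Fin n → ℕ) (S : Finset (Fin n)) (J : ℝ) : Finset (Fin n) :=
  S.filter fun v => (d v : ℝ) ≤ J

/-- The expected number of vertices of `lowPart d S J` with `i` neighbours in `S`, in the
binomial model. -/
noncomputable def lowMean (d : Fin n → ℕ) (S : Finset (Fin n)) (J : ℝ) (i : ℕ) : ℝ :=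
  ∑ v ∈ lowPart d S J, binomPmf (d v) (gam d S) i

theorem lowMean_nonneg (d : Fin n → ℕ) (S : Finset (Fin n)) (J : ℝ) (i : ℕ) :
    0 ≤ lowMean d S J i :=
  sum_nonneg fun _ _ => binomPmf_nonneg _ (gam_nonneg d S) (gam_le_one d S) _

theorem sum_sq_degCount_sub_le (h : Scales d S x L J) {i : ℕ}
    (hi : (i : ℝ) ≤ 1 / 2 * (gam d S * J)) :
    ∑ G ∈ graphs d, ((degCount G S (lowPart d S J) i : ℝ) - lowMean d S J i) ^ 2 ≤
      (2 * lowMean d S J i + 3 * (J⁻¹) ^ 8 * lowMean d S J i ^ 2) * (graphs d).card := by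
  have hJ := h.J_pos
  have hJ' := h.J_ge
  set y := J⁻¹ with hy
  have hy0 : 0 < y := by positivity
  have hy1 : y ≤ 1 / 100000 := by
    rw [hy, inv_eq_one_div]
    exact one_div_le_one_div_of_le (by norm_num) hJ'
  have hJy : J * y = 1 := mul_inv_cancel₀ hJ.ne'
  have hM4 : (totalM d : ℝ) / 2 ≤ totalM d - 4 * (maxDeg d : ℝ) ^ 2 := by
    linarith [h.eight_maxDeg_sq_lt]
  have hM0 := h.totalM_pos
  have p10 : 0 < y ^ 10 := by positivity
  have p8 : y ^ 10 ≤ y ^ 8 / 100 := by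
    have : y ^ 2 ≤ 1 / 100 := by nlinarith
    have : y ^ 8 * y ^ 2 ≤ y ^ 8 * (1 / 100) := by gcongr
    calc y ^ 10 = y ^ 8 * y ^ 2 := by ring
      _ ≤ _ := by linarith
  have p11 : y ^ 11 ≤ y ^ 10 := pow_le_pow_of_le_one hy0.le (by linarith) (by norm_num)
  have p11' : y ^ 11 ≤ 1 / 100000 := by
    calc y ^ 11 ≤ y ^ 1 := pow_le_pow_of_le_one hy0.le (by linarith) (by norm_num)
      _ ≤ _ := by simpa using hy1
  have p0 : 0 < y ^ 11 := by positivity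
  have p81 : y ^ 8 ≤ 1 := pow_le_one₀ hy0.le (by linarith)
  -- With y = 1/J: degrees at most J and ε = y¹² give q = 1 - y¹¹ by Bernoulli's inequality; i/γ ≤
  -- J/2 and M ≥ J¹² give κ = y¹⁰; and κ' = y⁸ dominates both.
  refine h.goodError.sum_sq_sub_le (filter_subset _ _) (fun v _ => h.one_le v) i
    (q := 1 - y ^ 11) (κ := y ^ 10) (by linarith) (by linarith) ?_ ?_ (by linarith) p10.le ?_
    (by linarith) p81
  · intro v hv
    have hdv : (d v : ℝ) ≤ J := (mem_filter.1 hv).2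
    have hε : -2 ≤ -(J ^ 12)⁻¹ := by
      have := h.goodError.le_one
      linarith
    have hb := one_add_mul_le_pow hε (d v)
    rw [← sub_eq_add_neg] at hb
    refine le_trans ?_ hb
    have : (d v : ℝ) * (J ^ 12)⁻¹ ≤ J * (J ^ 12)⁻¹ := by gcongr
    have e : J * (J ^ 12)⁻¹ = y ^ 11 := by
      rw [← inv_pow, ← hy]
      calc J * y ^ 12 = (J * y) * y ^ 11 := by ring
        _ = _ := by rw [hJy, one_mul]
    linarith
  · have hg := h.gam_pos
    have h1 : (i : ℝ) / gam d S ≤ J / 2 := by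
      rw [div_le_iff₀ hg]
      linarith
    have h0 : 0 ≤ (i : ℝ) / gam d S := by positivity
    have h2 : ((i : ℝ) / gam d S) ^ 2 ≤ (J / 2) ^ 2 := by gcongr
    have h3 := h.J_pow_le
    calc _ ≤ (J / 2) ^ 2 := h2
      _ ≤ J ^ 2 / 2 := by nlinarith [sq_nonneg J]
      _ = y ^ 10 * (J ^ 12 / 2) := by
        calc J ^ 2 / 2 = (J * y) ^ 10 * (J ^ 2 / 2) := by rw [hJy]; ring
          _ = _ := by ring
      _ ≤ y ^ 10 * (totalM d - 4 * (maxDeg d : ℝ) ^ 2) := by gcongr; linarith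
  · have : 1 - 2 * y ^ 11 ≤ (1 - y ^ 11) ^ 2 := by nlinarith [sq_nonneg (y ^ 11)]
    calc 1 + y ^ 10 ≤ (1 + y ^ 8) * (1 - 2 * y ^ 11) := by nlinarith
      _ ≤ _ := by gcongr

/-- The permitted deviation of the number of vertices with `i` neighbours in `S`. -/
noncomputable def deviation (d : Fin n → ℕ) (S : Finset (Fin n)) (J : ℝ) (i : ℕ) : ℝ :=
  gam d S * lowMean d S J i / J ^ 3 + gam d S * J ^ 5

open Classical in
theorem card_deviating_le (h : Scales d S x L J) {i : ℕ}
    (hi : (i : ℝ) ≤ 1 / 2 * (gam d S * J)) :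
    (((graphs d).filter fun G => deviation d S J i / 2 <
      |(degCount G S (lowPart d S J) i : ℝ) - lowMean d S J i|).card : ℝ) ≤
      14 / (gam d S * J) ^ 2 * (graphs d).card := by
  have hJ := h.J_pos
  have hg := h.gam_pos
  have hμ := lowMean_nonneg d S J i
  have h1 := h.sum_sq_degCount_sub_le hi
  have ht : 0 < deviation d S J i := by unfold deviation; positivity
  have h2 := card_filter_abs_mul_sq_le (graphs d)
    (fun G => (degCount G S (lowPart d S J) i : ℝ) - lowMean d S J i) (deviation d S J i / 2)
    (by linarith)
  have h3 := h2.trans h1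
  rw [← le_div_iff₀ (by positivity)] at h3
  refine h3.trans ?_
  rw [mul_div_right_comm]
  refine mul_le_mul_of_nonneg_right ?_ (Nat.cast_nonneg _)
  rw [div_le_div_iff₀ (by positivity) (by positivity)]
  -- The arithmetic-geometric mean inequality: the two parts of the deviation have product γ²J²μ,
  -- which controls the linear term of the second moment. The first part alone controls the
  -- quadratic term, in `e2`. With the halved deviation they contribute 2 and 12 to the constant 14.
  have e1 : 4 * gam d S ^ 2 * J ^ 2 * lowMean d S J i ≤ deviation d S J i ^ 2 := by
    have := four_mul_le_sq_add (gam d S * lowMean d S J i / J ^ 3) (gam d S * J ^ 5)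
    refine le_trans (le_of_eq ?_) this
    field_simp
  have e2 : gam d S ^ 2 * lowMean d S J i ^ 2 * (J⁻¹) ^ 6 ≤ deviation d S J i ^ 2 := by
    have : (gam d S * lowMean d S J i / J ^ 3) ^ 2 ≤ deviation d S J i ^ 2 := by
      unfold deviation
      gcongr
      have : 0 ≤ gam d S * J ^ 5 := by positivity
      linarith
    refine le_trans (le_of_eq ?_) this
    field_simp
  have e3 : 3 * (J⁻¹) ^ 8 * lowMean d S J i ^ 2 * (gam d S * J) ^ 2 =
      3 * (gam d S ^ 2 * lowMean d S J i ^ 2 * (J⁻¹) ^ 6) := by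
    field_simp
  nlinarith

open Classical in
theorem card_some_deviating_le (h : Scales d S x L J) :
    (((graphs d).filter fun G => ∃ i : ℕ, (i : ℝ) ≤ 1 / 2 * (gam d S * J) ∧
      deviation d S J i / 2 <
        |(degCount G S (lowPart d S J) i : ℝ) - lowMean d S J i|).card : ℝ) ≤
      14 / L * (graphs d).card := by
  have hL := h.L_le
  have hgJ := h.gam_mul_J
  have hpos : 0 ≤ 1 / 2 * (gam d S * J) := by linarith
  set K := ⌊1 / 2 * (gam d S * J)⌋₊ with hK
  have hKi : ∀ i : ℕ, i < K + 1 ↔ (i : ℝ) ≤ 1 / 2 * (gam d S * J) := fun i => by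
    rw [Nat.lt_succ_iff, hK, Nat.le_floor_iff hpos]
  have hsub : ((graphs d).filter fun G => ∃ i : ℕ, (i : ℝ) ≤ 1 / 2 * (gam d S * J) ∧
      deviation d S J i / 2 < |(degCount G S (lowPart d S J) i : ℝ) - lowMean d S J i|) ⊆
      (range (K + 1)).biUnion fun i => (graphs d).filter fun G => deviation d S J i / 2 <
      |(degCount G S (lowPart d S J) i : ℝ) - lowMean d S J i| := by
    intro G
    simp only [mem_filter, mem_biUnion, mem_range, hKi]
    grind
  calc _ ≤ ∑ i ∈ range (K + 1), (((graphs d).filter fun G => deviation d S J i / 2 <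
        |(degCount G S (lowPart d S J) i : ℝ) - lowMean d S J i|).card : ℝ) := by
        exact_mod_cast (card_le_card hsub).trans card_biUnion_le
    _ ≤ ∑ i ∈ range (K + 1), 14 / (gam d S * J) ^ 2 * ((graphs d).card : ℝ) :=
        sum_le_sum fun i hi => h.card_deviating_le ((hKi i).1 (mem_range.1 hi))
    _ = ((K : ℝ) + 1) * (14 / (gam d S * J) ^ 2 * ((graphs d).card : ℝ)) := by
        rw [sum_const, card_range, nsmul_eq_mul]; push_cast; rfl
    -- At most γJ values of i occur, so one of the two factors γJ in the denominator survives the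
    -- union bound.
    _ ≤ (gam d S * J) * (14 / (gam d S * J) ^ 2 * ((graphs d).card : ℝ)) := by
        gcongr
        have := Nat.floor_le hpos
        linarith
    _ = 14 / (gam d S * J) * ((graphs d).card : ℝ) := by
        have : gam d S * J ≠ 0 := by linarith
        field_simp
    _ ≤ _ := by
        gcongr
        linarith

/-- For degrees above J, a value i ≤ γJ/2 lies in the lower tail with η = 1/4, so these vertices add
almost nothing to the mean. -/
theorem abs_lowMean_sub_le (h : Scales d S x L J) {i : ℕ}
    (hi : (i : ℝ) ≤ 1 / 2 * (gam d S * J)) :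
    |lowMean d S J i - ∑ v ∈ S, binomPmf (d v) (gam d S) i| ≤ 1 / 2 := by
  have hsplit := sum_filter_add_sum_filter_not S (fun v => (d v : ℝ) ≤ J)
    fun v => binomPmf (d v) (gam d S) i
  have h0 : 0 ≤ ∑ v ∈ S.filter (fun v => ¬ (d v : ℝ) ≤ J), binomPmf (d v) (gam d S) i :=
    sum_nonneg fun _ _ => binomPmf_nonneg _ (gam_nonneg d S) (gam_le_one d S) _
  have h1 : ∑ v ∈ S.filter (fun v => ¬ (d v : ℝ) ≤ J), binomPmf (d v) (gam d S) i ≤ 1 / 2 := by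
    refine le_trans ?_ h.sum_tail_lt.le
    refine (sum_le_sum fun v hv => ?_).trans
      (sum_le_sum_of_subset_of_nonneg (filter_subset _ _) fun v _ _ => by positivity)
    have hdv : J ≤ d v := (not_le.1 (mem_filter.1 hv).2).le
    have := binomPmf_lower_tail h.gam_pos h.gam_lt_one (η := 1 / 4) (by norm_num) (by norm_num)
      h.J_pos.le hdv h.exponent_cutoff (k := i) (by linarith)
    refine this.trans (le_mul_of_one_le_left (Real.exp_pos _).le ?_)
    have : (0 : ℝ) ≤ d v := Nat.cast_nonneg _
    linarith
  unfold lowMean lowPart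
  rw [← hsplit, abs_le]
  constructor <;> linarith

variable {G : SimpleGraph (Fin n)}

/-- In a typical graph a vertex of degree above J has more than (1-5x)γJ > γJ/2 neighbours in `S`.
-/
theorem degCount_eq_of_typical (h : Scales d S x L J)
    (hG : ∀ v ∈ S, ¬ Atypical d S x J v (nb G v ∩ S).card) {i : ℕ}
    (hi : (i : ℝ) ≤ 1 / 2 * (gam d S * J)) : degCount G S S i = degCount G S (lowPart d S J) i := by
  unfold degCount lowPart
  rw [filter_filter]
  congr 1
  refine filter_congr fun v hv => ⟨fun hvi => ⟨?_, hvi⟩, fun hvi => hvi.2⟩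
  by_contra! hdv
  refine hG v hv (Or.inl ⟨h.x_sq_J_le.trans hdv.le, Or.inr ?_⟩)
  rw [hvi]
  have hx := h.x_le
  have hg := h.gam_pos
  have h1 : gam d S * J ≤ gam d S * d v := mul_le_mul_of_nonneg_left hdv.le hg.le
  have h2 := h.gam_mul_J
  have h3 := h.L_le
  nlinarith

theorem closeCounts_of_typical (h : Scales d S x L J)
    (hG : ∀ v ∈ S, ¬ Atypical d S x J v (nb G v ∩ S).card) {i : ℕ}
    (hi : (i : ℝ) ≤ 1 / 2 * (gam d S * J))
    (hdev : |(degCount G S (lowPart d S J) i : ℝ) - lowMean d S J i| ≤ deviation d S J i / 2) :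
    |(entryCount (inducedSeq G S) i : ℝ) - entryCount (modelSeq d S) i| ≤
      gam d S * entryCount (modelSeq d S) i / J ^ 3 + gam d S * J ^ 5 := by
  have hJ := h.J_pos
  have hJ1 := h.J_ge
  have hg := h.gam_pos
  have h1 := abs_le.1 (abs_entryCount_modelSeq_sub_le d S i)
  have h2 := abs_le.1 (h.abs_lowMean_sub_le hi)
  have h3 := abs_le.1 hdev
  rw [entryCount_inducedSeq, h.degCount_eq_of_typical hG hi]
  -- Only half of the permitted deviation is used by Chebyshev's inequality. The other half absorbs
  -- the rounding error 1, the error 1/2 from high degrees, and the passage from the mean to the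
  -- model count.
  have hbig : 6 ≤ gam d S * J ^ 5 := by
    have e : gam d S * J ^ 5 = (gam d S * J) * J ^ 4 := by ring
    have h4 : (1 : ℝ) ≤ J ^ 4 := one_le_pow₀ (by linarith)
    have h5 := h.gam_mul_J
    have h6 := h.L_le
    rw [e]
    nlinarith
  have hdiff : deviation d S J i ≤
      gam d S * entryCount (modelSeq d S) i / J ^ 3 + gam d S * J ^ 5 + 3 / 2 := by
    unfold deviation
    have hle : lowMean d S J i ≤ entryCount (modelSeq d S) i + 3 / 2 := by linarith
    have hgJ : gam d S / J ^ 3 ≤ 1 := by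
      rw [div_le_one (by positivity)]
      exact h.gam_lt_one.le.trans (one_le_pow₀ (by linarith))
    have hgJ0 : 0 ≤ gam d S / J ^ 3 := by positivity
    rw [mul_div_right_comm, mul_div_right_comm]
    nlinarith
  have hn : 0 ≤ gam d S * entryCount (modelSeq d S) i / J ^ 3 := by positivity
  rw [abs_le]
  constructor <;> linarith

theorem large_of_typical (h : Scales d S x L J)
    (hG : ∀ v ∈ S, ¬ Atypical d S x J v (nb G v ∩ S).card) {k : Fin S.card}
    (hk : x ^ 2 * J ≤ d (vtx S k)) :
    |(inducedSeq G S k : ℝ) - gam d S * d (vtx S k)| ≤ 8 * x * (gam d S * d (vtx S k)) ∧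
    |(inducedSeq G S k : ℝ) - modelSeq d S k| ≤ 12 * x * (modelSeq d S k : ℝ) := by
  have hx := h.x_pos
  have hx' := h.x_le
  have ht := hG (vtx S k) (by exact_mod_cast vtx_mem S k)
  simp only [Atypical, not_or, not_and, not_le] at ht
  obtain ⟨h1, h2⟩ := ht.1 hk
  rw [← inducedSeq_eq] at h1 h2
  have m1 := modelSeq_le h.mono h.gam_pos h.gam_lt_one (η := 5 / 2 * x) (by positivity)
    (by linarith) (h.exponent_large hk) h.sum_tail_lt.le (k := k) le_rfl
  have m2 := le_modelSeq h.mono h.gam_pos h.gam_lt_one (η := 5 / 2 * x) (by positivity)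
    (by linarith) (h.exponent_large hk) h.sum_tail_lt (Nat.cast_nonneg _) (k := k) le_rfl
  have hg : 0 ≤ gam d S * d (vtx S k) := mul_nonneg h.gam_pos.le (Nat.cast_nonneg _)
  set g := gam d S * d (vtx S k)
  have hxg : 0 ≤ x * g := by positivity
  have hxx : x * (x * g) ≤ 1 / 100 * (x * g) := by gcongr
  -- Both sequences lie within 5x·g of g, so they differ by at most 10x·g, and 10g ≤ 12(1-5x)g
  -- because x ≤ 1/100.
  have m3 : x * ((1 - 2 * (5 / 2 * x)) * g) ≤ x * modelSeq d S k := by gcongr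
  rw [abs_le, abs_le]
  refine ⟨⟨?_, ?_⟩, ?_, ?_⟩ <;> linarith

theorem small_of_typical (h : Scales d S x L J)
    (hG : ∀ v ∈ S, ¬ Atypical d S x J v (nb G v ∩ S).card) {k : Fin S.card}
    (hk : (d (vtx S k) : ℝ) ≤ x ^ 2 * J) :
    max (inducedSeq G S k : ℝ) (modelSeq d S k : ℝ) ≤ 2 * (gam d S * (x ^ 2 * J)) := by
  have ht := hG (vtx S k) (by exact_mod_cast vtx_mem S k)
  simp only [Atypical, not_or, not_and, not_le] at ht
  have h1 := ht.2 hk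
  rw [← inducedSeq_eq] at h1
  have m1 := modelSeq_le h.mono h.gam_pos h.gam_lt_one (η := 1 / 2) (by norm_num) le_rfl
    h.exponent_small h.sum_tail_lt.le hk
  exact max_le h1.le (m1.trans (by linarith))

theorem graphs_nonempty (h : Scales d S x L J) (heven : Even (totalM d)) :
    (graphs d).Nonempty := by
  refine InducedDegrees.graphs_nonempty heven h.one_le_maxDeg ?_
  have h1 := h.eight_maxDeg_sq_lt
  have : 8 * maxDeg d ^ 2 < totalM d := by exact_mod_cast h1
  omega

end Scales

theorem prob_eq {d : Fin n → ℕ} (E : SimpleGraph (Fin n) → Prop) [DecidablePred E] :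
    prob d E = ((graphs d).filter E).card / (graphs d).card := by
  unfold prob
  congr 2
  · rw [← Set.ncard_coe_finset]
    congr 1
    ext G
    simp [graphs]
  · rw [← Set.ncard_coe_finset]
    congr 1
    ext G
    simp [graphs]

theorem Scales.le_prob {d : Fin n → ℕ} {S : Finset (Fin n)} {x L J : ℝ} (h : Scales d S x L J)
    (heven : Even (totalM d)) {E : SimpleGraph (Fin n) → Prop}
    (hE : ∀ G, (∀ v ∈ S, ¬ Scales.Atypical d S x J v (nb G v ∩ S).card) →
      (∀ i : ℕ, (i : ℝ) ≤ 1 / 2 * (gam d S * J) →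
        |(degCount G S (Scales.lowPart d S J) i : ℝ) - Scales.lowMean d S J i| ≤
          Scales.deviation d S J i / 2) → E G) :
    1 - 15 / L ≤ prob d E := by
  classical
  have hpos : (0 : ℝ) < (graphs d).card := by exact_mod_cast (h.graphs_nonempty heven).card_pos
  rw [prob_eq, le_div_iff₀ hpos]
  have h1 := h.card_atypical_le
  have h2 := h.card_some_deviating_le
  have hsub : graphs d ⊆ (graphs d).filter E ∪
      ((graphs d).filter (fun G => ∃ v ∈ S, Scales.Atypical d S x J v (nb G v ∩ S).card) ∪
      (graphs d).filter fun G => ∃ i : ℕ, (i : ℝ) ≤ 1 / 2 * (gam d S * J) ∧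
        Scales.deviation d S J i / 2 <
          |(degCount G S (Scales.lowPart d S J) i : ℝ) - Scales.lowMean d S J i|) := by
    intro G hG
    simp only [mem_union, mem_filter, hG, true_and]
    by_contra! hcon
    exact hcon.1 (hE G hcon.2.1 hcon.2.2)
  have h3 := (card_le_card hsub).trans ((card_union_le _ _).trans
    (Nat.add_le_add_left (card_union_le _ _) _))
  have h4 := (Nat.cast_le (α := ℝ)).2 h3
  push_cast at h4
  have e : (1 - 15 / L) * ((graphs d).card : ℝ) =
      (graphs d).card - (1 / L * (graphs d).card + 14 / L * (graphs d).card) := by ring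
  rw [e]
  linarith

end Main
end InducedDegrees

theorem theorem2p3 :
    ∀ c : ℝ, 0 < c →
      ∃ C δ₀ M₀ : ℝ, 0 < C ∧ 0 < δ₀ ∧
        ∀ (n : ℕ) (d : Fin n → ℕ) (S : Finset (Fin n)) (δ : ℝ),
          Monotone d → (∀ v, 1 ≤ d v) → Even (InducedDegrees.totalM d) →
          S.Nonempty →
          InducedDegrees.gam d S < 1 - c →
          0 < δ → δ ≤ δ₀ → M₀ ≤ (InducedDegrees.totalM d : ℝ) →
          (InducedDegrees.maxDeg d : ℝ) ^ 2 *
              ((InducedDegrees.gam d S)⁻¹ * Real.log (InducedDegrees.totalM d)) ^ 12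
            ≤ δ * (InducedDegrees.totalDeg d S : ℝ) →
          (∃ G : SimpleGraph (Fin n), InducedDegrees.HasDegrees d G) ∧
          1 - C / Real.sqrt (Real.log (InducedDegrees.totalM d))
            ≤ InducedDegrees.prob d (fun G =>
                InducedDegrees.LargeDegrees d S δ G ∧
                InducedDegrees.SmallDegrees d S δ G ∧
                InducedDegrees.CloseCounts d S δ G) := by
  open InducedDegrees in
  intro c hc
  have hx₀ : 0 < min (1 / 100) c := by positivity
  -- With x = δ^(1/64), this δ₀ gives x ≤ 1/100 and x ≤ c, hence 1-c < 1-6x¹⁶, and M₀ gives L ≥ 100.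
  -- The failure probability is in fact at most 15/L.
  refine ⟨15, min (1 / 100) c ^ 64, Real.exp 100, by norm_num, by positivity, ?_⟩
  intro n d S δ hmono hone heven hS hγ hδ hδ₀ hM₀ hdeg
  set L := Real.log (totalM d) with hL
  have hM : 0 < (totalM d : ℝ) := (Real.exp_pos _).trans_le hM₀
  have hL100 : 100 ≤ L := (Real.le_log_iff_exp_le hM).2 hM₀
  set x := δ ^ (1 / 64 : ℝ) with hx
  have hx0 : 0 < x := Real.rpow_pos_of_pos hδ _
  have hxδ : δ = x ^ 64 := by
    rw [hx, ← Real.rpow_natCast, ← Real.rpow_mul hδ.le]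
    norm_num
  have hxle : x ≤ min (1 / 100) c := by
    rw [hxδ] at hδ₀
    exact le_of_pow_le_pow_left₀ (by norm_num) hx₀.le hδ₀
  have hx100 : x ≤ 1 / 100 := hxle.trans (min_le_left _ _)
  have hxc : x ≤ c := hxle.trans (min_le_right _ _)
  have hx32 : δ ^ (1 / 32 : ℝ) = x ^ 2 := by
    rw [hx, ← Real.rpow_natCast, ← Real.rpow_mul hδ.le]
    norm_num
  have hx16 : δ ^ (-(1 / 16) : ℝ) = (x ^ 4)⁻¹ := by
    rw [hx, ← Real.rpow_natCast, ← Real.rpow_mul hδ.le, ← Real.rpow_neg hδ.le]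
    norm_num
  have hγ0 : 0 < gam d S := by
    obtain ⟨v, hv⟩ := hS
    have h1 : 0 < totalDeg d S := Finset.sum_pos (fun v _ => hone v) ⟨v, hv⟩
    unfold gam
    positivity
  set J := cutoff d S δ with hJdef
  have hJ : J = (x ^ 4)⁻¹ * (gam d S)⁻¹ * L := by rw [hJdef, cutoff, hx16]
  have h : Scales d S x L J :=
    { mono := hmono
      one_le := hone
      nonempty := hS
      x_pos := hx0
      x_le := hx100
      L_le := hL100
      exp_L := Real.exp_log hM
      J_eq := by rw [hJ]; field_simp
      gam_lt := by
        have h1 : x ^ 15 ≤ (1 / 100) ^ 15 := pow_le_pow_left₀ hx0.le hx100 15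
        have h2 : x ^ 16 = x ^ 15 * x := by ring
        have h3 : x ^ 15 * x ≤ (1 / 100) ^ 15 * x := by gcongr
        have h4 : 6 * ((1 / 100 : ℝ) ^ 15 * x) ≤ x := by nlinarith
        linarith
      degree := by
        have e1 : (gam d S)⁻¹ * L = x ^ 4 * J := by rw [hJ]; field_simp
        have e2 : (totalDeg d S : ℝ) = gam d S * totalM d := by unfold gam; field_simp
        rw [e1, e2, hxδ] at hdeg
        -- Since γ⁻¹ log M = x⁴J and δ = x⁶⁴, the degree hypothesis is the goal multiplied by x⁴⁸.
        refine le_of_mul_le_mul_left ?_ (by positivity : 0 < x ^ 48)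
        calc _ = (maxDeg d : ℝ) ^ 2 * (x ^ 4 * J) ^ 12 := by ring
          _ ≤ _ := hdeg
          _ = _ := by ring }
  constructor
  · obtain ⟨G, hG⟩ := h.graphs_nonempty heven
    exact ⟨G, by simpa [graphs] using hG⟩
  · have hsqrt : Real.sqrt L ≤ L := by
      rw [Real.sqrt_le_left (by linarith)]
      nlinarith
    have hfrac : 15 / L ≤ 15 / Real.sqrt L := by
      have : 0 < Real.sqrt L := Real.sqrt_pos.2 (by linarith)
      gcongr
    refine le_trans (by linarith) (h.le_prob heven ?_)
    intro G hG hdev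
    refine ⟨fun k hk => ?_, fun k hk => ?_, fun i hi => ?_⟩
    · rw [hx32] at hk
      exact h.large_of_typical hG hk
    · rw [hx32] at hk ⊢
      exact (h.small_of_typical hG hk.le).trans_eq (by ring)
    · have hi' : (i : ℝ) ≤ 1 / 2 * (gam d S * J) := by rwa [← mul_assoc]
      exact h.closeCounts_of_typical hG hi' (hdev i hi')
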